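/- Let $m,n,k,p\ge 1$ be integers and $d=mk$. For $1\le i\le m$ let $P_i\in\mathbb R^{k\times d}$ be the $i$-th patch matrix $P_i=[\,0\;\cdots\;0\;I_k\;0\;\cdots\;0\,]$ (identity in the $i$-th block of $k$ columns), and let $\psi(t)=\max(0,t)$, applied entrywise. Let $x_1,\dots,x_n$ be independent $\mathcal N(0,I_d)$ vectors, $X=[x_1,\dots,x_n]$, and let $W=[W_1,\dots,W_p]$, where $W_1,\dots,W_p$ are independent $\mathcal N(0,k^{-1}I_k)$ vectors that are independent of $X$. Put $$A_W=[P_1X,\dots,P_mX]\in\mathbb R^{k\times mn},\qquad A_\beta=\Big[\sum_{i=1}^m\psi(W^TP_ix_1),\dots,\sum_{i=1}^m\psi(W^TP_ix_n)\Big]\in\mathbb R^{p\times n}.$$ For a matrix $A$ with rows $A_1,\dots,A_{|A|}\in\mathbb R^{D_A}$, real numbers $c_1,\dots,c_{|A|}$, and parameters $\sigma^2,\underline\lambda,\bar\lambda$, consider the conditions $$\Big\|\frac1{|A|}\sum_{i=1}^{|A|}c_iA_i\Big\|^2\le\frac{\sigma^2D_A}{|A|},\qquad \inf_{\|\Delta\|=1}\frac1{|A|}\sum_{i=1}^{|A|}|A_i^T\Delta|\ge\underline\lambda,\qquad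 \sup_{\|\Delta\|=1}\frac1{|A|}\sum_{i=1}^{|A|}|A_i^T\Delta|^2\le\bar\lambda^2 .$$ (a) There are absolute constants $\underline\lambda,\bar\lambda>0$ such that for every $\delta>0$ there are $\sigma^2>0$ and $\kappa>0$, depending only on $\delta$, with the following property: whenever $mn/k\le\kappa$, for all fixed $c_1,\dots,c_k$ with $\max_i|c_i|\le1$ the matrix $A=A_W$ (so $|A|=k$, $D_A=mn$) satisfies the three conditions simultaneously with probability at least $1-\delta$. (b) There are absolute constants $C_1,C_2,\underline\lambda>0$ such that for every $\delta>0$ there is $\kappa>0$, depending only on $\delta$, with the following property: whenever $mn/\sqrt p\le\kappa$, $n\log(mn)/k\le\kappa$ and $n/k\le\kappa$, for all fixed $c_1,\dots,c_p$ with $\max_j|c_j|\le1$ the matrix $A=A_\beta$ (so $|A|=p$, $D_A=n$) satisfies the three conditions simultaneously with probability at least $1-\delta$, where $\sigma^2=C_1m^2p$ and $\bar\lambda^2=C_2m^2n$. -/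

import Mathlib

open MeasureTheory ProbabilityTheory

/-- The ReLU activation. -/
def relu (t : ℝ) : ℝ := max 0 t

/-- The `i`-th patch matrix `[0 ⋯ 0 I_k 0 ⋯ 0]` of size `k × (m k)`, whose identity block occupies
the columns `k i, …, k i + k - 1` (the indices are counted from zero). -/
def patchMatrix {m k : ℕ} (i : Fin m) : Matrix (Fin k) (Fin (m * k)) ℝ :=
  Matrix.of fun r c => if (c : ℕ) = k * (i : ℕ) + (r : ℕ) then 1 else 0

/-- The hidden-layer design matrix `A_W = [P_1 X, …, P_m X]`, of size `k × (m n)`, where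
`X = [x_1, …, x_n]`: the column with index `(i, s)` is the patch `P_i x_s`. -/
def designW {m n k : ℕ} (x : Fin n → EuclideanSpace ℝ (Fin (m * k))) :
    Matrix (Fin k) (Fin m × Fin n) ℝ :=
  Matrix.of fun r is => (patchMatrix is.1).mulVec (x is.2).ofLp r

/-- The output-layer design matrix `A_β = [∑ i, ψ(Wᵀ P_i x_1), …, ∑ i, ψ(Wᵀ P_i x_n)]`, of size
`p × n`, where `W = [w_1, …, w_p]` and the ReLU `ψ` acts entrywise: the entry with index `(j, s)`
is `∑ i, ψ(w_jᵀ P_i x_s)`. -/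
def designBeta {m n k p : ℕ} (x : Fin n → EuclideanSpace ℝ (Fin (m * k)))
    (w : Fin p → EuclideanSpace ℝ (Fin k)) : Matrix (Fin p) (Fin n) ℝ :=
  Matrix.of fun j s =>
    ∑ i : Fin m, relu (dotProduct (w j).ofLp ((patchMatrix i).mulVec (x s).ofLp))

section Conditions

variable {N : ℕ} {ι : Type*} [Fintype ι]

/-- For a matrix with rows `a_1, …, a_N` in `ℝ^D`: `‖(1/N) ∑ i, c_i a_i‖² ≤ σ² D / N`, in the
Euclidean norm. -/
def WeightedAverageBound (A : Matrix (Fin N) ι ℝ) (c : Fin N → ℝ) (σsq : ℝ) : Prop :=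
  ‖(1 / (N : ℝ)) • ∑ i, c i • (WithLp.toLp 2 (A i) : EuclideanSpace ℝ ι)‖ ^ 2
    ≤ σsq * (Fintype.card ι : ℝ) / (N : ℝ)

/-- `inf_{‖Δ‖ = 1} (1/N) ∑ i, |a_iᵀ Δ| ≥ lam`. -/
def SmallBallLowerBound (A : Matrix (Fin N) ι ℝ) (lam : ℝ) : Prop :=
  ∀ Δ : EuclideanSpace ℝ ι, ‖Δ‖ = 1 → lam ≤ (1 / (N : ℝ)) * ∑ i, |∑ t, A i t * Δ t|

/-- `sup_{‖Δ‖ = 1} (1/N) ∑ i, |a_iᵀ Δ|² ≤ lamsq`. -/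
def QuadraticUpperBound (A : Matrix (Fin N) ι ℝ) (lamsq : ℝ) : Prop :=
  ∀ Δ : EuclideanSpace ℝ ι, ‖Δ‖ = 1 → (1 / (N : ℝ)) * ∑ i, |∑ t, A i t * Δ t| ^ 2 ≤ lamsq

/-- The three conditions together. -/
def DesignConditions (A : Matrix (Fin N) ι ℝ) (c : Fin N → ℝ) (σsq lamLow lamHighSq : ℝ) : Prop :=
  WeightedAverageBound A c σsq ∧ SmallBallLowerBound A lamLow ∧ QuadraticUpperBound A lamHighSq

end Conditions

section Model

variable {Ω : Type*} [MeasurableSpace Ω]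

/-- The inputs `x_1, …, x_n` are independent standard Gaussian vectors in `ℝ^d`. -/
structure GaussianInputs {d n : ℕ} (x : Fin n → Ω → EuclideanSpace ℝ (Fin d)) (P : Measure Ω) :
    Prop where
  law : ∀ s, HasLaw (x s) (stdGaussian (EuclideanSpace ℝ (Fin d))) P
  indep : iIndepFun x P

/-- The initial hidden weights `w_1, …, w_p` are independent with law `N(0, k⁻¹ I_k)`. -/
structure GaussianWeights {k p : ℕ} (w : Fin p → Ω → EuclideanSpace ℝ (Fin k)) (P : Measure Ω) :
    Prop where
  law : ∀ j, HasLaw (w j)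
    (multivariateGaussian (0 : EuclideanSpace ℝ (Fin k))
      ((k : ℝ)⁻¹ • (1 : Matrix (Fin k) (Fin k) ℝ))) P
  indep : iIndepFun w P

end Model

/-! Hidden layer. Entry `(i, s)` of row `r` of `A_W` is coordinate `(i, r)` of `x_s`, so the `k`
rows are independent standard Gaussian vectors in dimension `mn` (`map_rowsW`). The weighted average
has mean square at most `mn/k`, and Markov's inequality gives the first condition. For a fixed unit
`Δ`, Chernoff's bound controls the averages of `|⟨a_r, Δ⟩|` and `⟨a_r, Δ⟩²` up to probability
`exp(-ck)`. A net of the sphere has `exp(O(mn))` points, so a union bound works once `mn/k` is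
small, and an operator norm estimate passes from the net to the sphere.
`exists_gaussian_rows_bounds` does this on any isometrically embedded subspace, at the cost of its
own dimension only.

Output layer. Given `X`, the rows are independent functions of the standard Gaussians `g_j = √k
w_j`, with `u_{i,s} = P_i x_s / √k`. Write `h(g) = ∑ Δ_s ψ(⟨g, u_{i,s}⟩)`. Since `ψ(t) - ψ(-t) = t`,
one has `h(g) - h(-g) = ⟨g, b⟩` with `b = ∑ Δ_s u_{i,s}`. As `g` and `-g` have the same law, a lower
bound on `‖b‖` gives a small-ball estimate for `h` (`lintegral_exp_neg_abs_reluFeature_le`). That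
lower bound is the hidden-layer estimate on vectors constant in the patch index, a subspace of
dimension `n`, so `n/k` small suffices. The other two conditions follow by Cauchy–Schwarz from a
Frobenius bound of order `m²np` (`designConditions_of_sum_sq_le`). The net now has mesh of order
`1/(m√n)`, hence at most `exp(O((mn)²))` points, which `exp(-lp)` beats when `(mn)²/p` is small.
Fubini's theorem (`measureReal_prod_le`) removes the conditioning. -/

/-! ### Sphere nets, Chernoff's bound and one-dimensional exponential moments -/

open scoped ENNReal in
/-- The unit sphere of a finite-dimensional normed space has `ε`-nets of exponential size. -/
lemma exists_sphere_net {E : Type*} [NormedAddCommGroup E] [NormedSpace ℝ E]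
    [FiniteDimensional ℝ E] {ε : ℝ} (hε : 0 < ε) :
    ∃ S : Finset E, (∀ y ∈ S, ‖y‖ = 1) ∧ (S.card : ℝ) ≤ Real.exp (2 * Module.finrank ℝ E / ε) ∧
      ∀ x : E, ‖x‖ = 1 → ∃ y ∈ S, ‖x - y‖ ≤ ε := by
  classical
  let good : Finset E → Prop := fun s =>
    (∀ y ∈ s, ‖y‖ = 1) ∧ ∀ c ∈ s, ∀ d ∈ s, c ≠ d → ε < ‖c - d‖
  -- Volume comparison: the balls of radius `ε / 2` around separated points are disjoint and lie in
  -- the ball of radius `1 + ε / 2`.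
  have card_le : ∀ s, good s → (s.card : ℝ) ≤ Real.exp (2 * Module.finrank ℝ E / ε) := by
    rintro s ⟨hs, h⟩
    borelize E
    let μ : Measure E := Measure.addHaar
    have hδ : 0 < ε / 2 := by positivity
    have hρ : 0 < 1 + ε / 2 := by positivity
    have D : Set.Pairwise (s : Set E)
        (Function.onFun Disjoint fun c => Metric.ball (c : E) (ε / 2)) := by
      rintro c hc d hd hcd
      apply Metric.ball_disjoint_ball
      rw [dist_eq_norm]
      linarith [h c hc d hd hcd]
    have A_subset : (⋃ c ∈ s, Metric.ball (c : E) (ε / 2)) ⊆ Metric.ball (0 : E) (1 + ε / 2) := by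
      refine Set.iUnion₂_subset fun x hx => ?_
      apply Metric.ball_subset_ball'
      rw [dist_zero_right, hs x hx, add_comm]
    have I : (s.card : ℝ≥0∞) * ENNReal.ofReal ((ε / 2) ^ Module.finrank ℝ E) *
        μ (Metric.ball 0 1) ≤
        ENNReal.ofReal ((1 + ε / 2) ^ Module.finrank ℝ E) * μ (Metric.ball 0 1) :=
      calc
        _ = μ (⋃ c ∈ s, Metric.ball (c : E) (ε / 2)) := by
          rw [measure_biUnion_finset D fun c _ => measurableSet_ball]
          simp only [μ.addHaar_ball_of_pos _ hδ]
          simp only [Finset.sum_const, nsmul_eq_mul, mul_assoc]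
        _ ≤ μ (Metric.ball (0 : E) (1 + ε / 2)) := measure_mono A_subset
        _ = _ := by simp only [μ.addHaar_ball_of_pos _ hρ]
    have J := (ENNReal.mul_le_mul_iff_left
      (Metric.measure_ball_pos _ _ zero_lt_one).ne' measure_ball_lt_top.ne).1 I
    have K := ENNReal.toReal_le_of_le_ofReal (pow_nonneg hρ.le _) J
    rw [ENNReal.toReal_mul, ENNReal.toReal_ofReal (by positivity), ENNReal.toReal_natCast,
      ← le_div_iff₀ (by positivity), ← div_pow] at K
    have e : (1 + ε / 2) / (ε / 2) = 2 / ε + 1 := by field_simp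
    rw [e] at K
    refine K.trans ?_
    calc (2 / ε + 1) ^ Module.finrank ℝ E ≤ Real.exp (2 / ε) ^ Module.finrank ℝ E := by
          gcongr; exact Real.add_one_le_exp _
      _ = _ := by rw [← Real.exp_nat_mul]; congr 1; ring
  obtain ⟨B, hB⟩ := exists_nat_ge (Real.exp (2 * Module.finrank ℝ E / ε))
  -- A separated set of maximal cardinality is a net, since a point at distance more than `ε` from
  -- it could be adjoined.
  let cards : Set ℕ := {k | ∃ s, good s ∧ s.card = k}
  have hne : cards.Nonempty := ⟨0, ∅, by simp [good], rfl⟩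
  have hbdd : BddAbove cards := by
    refine ⟨B, ?_⟩
    rintro _ ⟨s, hs, rfl⟩
    exact_mod_cast (card_le s hs).trans hB
  obtain ⟨S, hS, hcard⟩ := Nat.sSup_mem hne hbdd
  refine ⟨S, hS.1, card_le S hS, fun x hx => ?_⟩
  by_contra! hfar
  have hxS : x ∉ S := fun hxS => by
    have := hfar x hxS
    simp at this
    linarith
  have hins : good (insert x S) := by
    refine ⟨fun y hy => ?_, fun c hc d hd hcd => ?_⟩
    · rcases Finset.mem_insert.1 hy with rfl | hy
      exacts [hx, hS.1 y hy]
    · rcases Finset.mem_insert.1 hc with rfl | hc' <;>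
        rcases Finset.mem_insert.1 hd with rfl | hd'
      · exact absurd rfl hcd
      · exact hfar d hd'
      · rw [norm_sub_rev]; exact hfar c hc'
      · exact hS.2 c hc' d hd' hcd
  have := le_csSup hbdd ⟨insert x S, hins, rfl⟩
  rw [Finset.card_insert_of_notMem hxS, hcard] at this
  omega

/-- Chernoff's bound for a sum of i.i.d. variables on a product space. -/
lemma measureReal_le_sum_le_of_lintegral_exp_le {F : Type*} [MeasurableSpace F] (ν : Measure F)
    [IsProbabilityMeasure ν] {f : F → ℝ} (hf : Measurable f) {K : ℝ}
    (hK : ∫⁻ g, ENNReal.ofReal (Real.exp (f g)) ∂ν ≤ ENNReal.ofReal K) (hK0 : 0 ≤ K)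
    (N : ℕ) (t : ℝ) :
    (Measure.pi fun _ : Fin N => ν).real {g | t * N ≤ ∑ j, f (g j)} ≤ (Real.exp (-t) * K) ^ N := by
  have hmeas : Measurable fun g => ENNReal.ofReal (Real.exp (f g)) := by fun_prop
  have hind : iIndepFun (fun (j : Fin N) (g : Fin N → F) => ENNReal.ofReal (Real.exp (f (g j))))
      (Measure.pi fun _ : Fin N => ν) :=
    iIndepFun_pi (X := fun _ g => ENNReal.ofReal (Real.exp (f g))) fun _ => hmeas.aemeasurable
  have hint : ∫⁻ g, ∏ j, ENNReal.ofReal (Real.exp (f (g j))) ∂(Measure.pi fun _ : Fin N => ν) ≤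
      ENNReal.ofReal K ^ N := by
    rw [lintegral_prod_eq_prod_lintegral_of_indepFun _ _ hind (by fun_prop)]
    have : ∀ j : Fin N, ∫⁻ g, ENNReal.ofReal (Real.exp (f (g j))) ∂(Measure.pi fun _ : Fin N => ν) ≤
        ENNReal.ofReal K := fun j => by
      rw [(measurePreserving_eval (fun _ : Fin N => ν) j).lintegral_comp hmeas]
      exact hK
    exact (Finset.prod_le_prod' fun j _ => this j).trans (by simp)
  have hmarkov : ENNReal.ofReal (Real.exp (t * N)) *
      (Measure.pi fun _ : Fin N => ν) {g | t * N ≤ ∑ j, f (g j)} ≤ ENNReal.ofReal K ^ N := by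
    refine le_trans ?_ hint
    refine le_trans (mul_le_mul_right (measure_mono fun g hg => ?_) _)
      (mul_meas_ge_le_lintegral₀ (Measurable.aemeasurable (by fun_prop)) _)
    simp only [Set.mem_ofPred_eq] at hg ⊢
    rw [← ENNReal.ofReal_prod_of_nonneg (fun _ _ => (Real.exp_pos _).le), ← Real.exp_sum]
    exact ENNReal.ofReal_le_ofReal (Real.exp_le_exp.2 hg)
  rw [← ENNReal.ofReal_pow hK0] at hmarkov
  have := ENNReal.toReal_mono ENNReal.ofReal_ne_top hmarkov
  rw [ENNReal.toReal_mul, ENNReal.toReal_ofReal (Real.exp_pos _).le,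
    ENNReal.toReal_ofReal (by positivity)] at this
  rw [mul_pow, ← Real.exp_nat_mul, mul_neg, Real.exp_neg, mul_comm (N : ℝ) t, inv_mul_eq_div,
    le_div_iff₀ (Real.exp_pos _), mul_comm]
  exact this

/-- Fernique's theorem supplies `C`. Having `K ≥ 1` makes `log K` nonnegative and covers zero
vectors in later quadratic forms. -/
lemma exists_lintegral_exp_mul_sq_gaussianReal_le :
    ∃ C K : ℝ, 0 < C ∧ 1 ≤ K ∧
      ∫⁻ x, ENNReal.ofReal (Real.exp (C * x ^ 2)) ∂(gaussianReal 0 1) ≤ ENNReal.ofReal K := by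
  obtain ⟨C, hC, hint⟩ := IsGaussian.exists_integrable_exp_sq (gaussianReal 0 1)
  simp only [Real.norm_eq_abs, sq_abs] at hint
  refine ⟨C, max 1 (∫ x, Real.exp (C * x ^ 2) ∂(gaussianReal 0 1)), hC, le_max_left _ _, ?_⟩
  rw [← ofReal_integral_eq_lintegral_ofReal hint (.of_forall fun _ => (Real.exp_pos _).le)]
  exact ENNReal.ofReal_le_ofReal (le_max_right _ _)

/-- The integrand is below `1` except at `0`, a null set, so its mean is strictly below `1`; this
gap drives every lower bound. -/
lemma exists_lintegral_exp_neg_abs_gaussianReal_le :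
    ∃ ρ : ℝ, 0 < ρ ∧ ρ < 1 ∧
      ∫⁻ x, ENNReal.ofReal (Real.exp (-|x|)) ∂(gaussianReal 0 1) ≤ ENNReal.ofReal ρ := by
  have hint : Integrable (fun x : ℝ => Real.exp (-|x|)) (gaussianReal 0 1) := by
    refine Integrable.of_bound (by fun_prop) 1 (.of_forall fun x => ?_)
    rw [Real.norm_of_nonneg (Real.exp_pos _).le]
    exact Real.exp_le_one_iff.2 (by simp)
  refine ⟨∫ x, Real.exp (-|x|) ∂(gaussianReal 0 1), integral_exp_pos hint, ?_, ?_⟩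
  · have hpos : 0 < ∫ x, (1 - Real.exp (-|x|)) ∂(gaussianReal 0 1) := by
      rw [integral_pos_iff_support_of_nonneg (f := fun x : ℝ => 1 - Real.exp (-|x|)) _
        ((integrable_const _).sub hint)]
      · have hs : Function.support (fun x : ℝ => 1 - Real.exp (-|x|)) = {0}ᶜ := by
          ext x
          rw [Function.mem_support, sub_ne_zero, Set.mem_compl_singleton_iff, Ne, eq_comm,
            Real.exp_eq_one_iff, neg_eq_zero, abs_eq_zero]
        rw [hs]
        have := nullSingletonClass_gaussianReal (μ := 0) (v := 1) one_ne_zero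
        rw [measure_compl (measurableSet_singleton _) (measure_ne_top _ _)]
        simp
      · intro x
        simp
    rw [integral_sub (integrable_const _) hint] at hpos
    simp at hpos
    linarith
  · rw [ofReal_integral_eq_lintegral_ofReal hint (.of_forall fun _ => (Real.exp_pos _).le)]

/-! ### Gaussian laws: projections, rescaling and the rows of `A_W` -/

lemma patchMatrix_mulVec {m k : ℕ} (i : Fin m) (v : Fin (m * k) → ℝ) (r : Fin k) :
    (patchMatrix i).mulVec v r = v (finProdFinEquiv (i, r)) := by
  have h : ∀ c : Fin (m * k), (c : ℕ) = k * (i : ℕ) + (r : ℕ) ↔ c = finProdFinEquiv (i, r) :=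
    fun c => by
      rw [Fin.ext_iff, finProdFinEquiv_apply_val, add_comm]
  simp [Matrix.mulVec, dotProduct, patchMatrix, h]

lemma map_inner_stdGaussian {E : Type*} [NormedAddCommGroup E] [InnerProductSpace ℝ E]
    [FiniteDimensional ℝ E] [MeasurableSpace E] [BorelSpace E] {a : E} (ha : ‖a‖ = 1) :
    (stdGaussian E).map (fun g => inner ℝ g a) = gaussianReal 0 1 := by
  apply Measure.ext_of_charFun
  ext t
  rw [charFun_apply_real, integral_map (by fun_prop) (by fun_prop)]
  have : ∀ g : E, (t : ℂ) * ((inner ℝ g a : ℝ) : ℂ) * Complex.I =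
      ((inner ℝ g (t • a) : ℝ) : ℂ) * Complex.I := fun g => by
    rw [real_inner_smul_right]; push_cast; ring
  simp_rw [this]
  rw [← charFun_apply, charFun_stdGaussian, charFun_gaussianReal, norm_smul, ha]
  simp [← Complex.ofReal_pow, neg_div]

lemma map_neg_stdGaussian {E : Type*} [NormedAddCommGroup E] [InnerProductSpace ℝ E]
    [FiniteDimensional ℝ E] [MeasurableSpace E] [BorelSpace E] :
    (stdGaussian E).map (fun g => -g) = stdGaussian E :=
  stdGaussian_map (LinearIsometryEquiv.neg ℝ (E := E))

lemma map_smul_multivariateGaussian {k : ℕ} (hk : 1 ≤ k) :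
    (multivariateGaussian (0 : EuclideanSpace ℝ (Fin k))
      ((k : ℝ)⁻¹ • (1 : Matrix (Fin k) (Fin k) ℝ))).map (fun w => √k • w) =
      stdGaussian (EuclideanSpace ℝ (Fin k)) := by
  have hk' : (0 : ℝ) < k := by exact_mod_cast hk
  have hS : ((k : ℝ)⁻¹ • (1 : Matrix (Fin k) (Fin k) ℝ)).PosSemidef :=
    Matrix.PosSemidef.one.smul (by positivity)
  apply Measure.ext_of_charFun
  ext t
  rw [charFun_map_smul, charFun_multivariateGaussian hS, charFun_stdGaussian]
  congr 1
  have h : (WithLp.ofLp (√k • t)) ⬝ᵥ ((k : ℝ)⁻¹ • (1 : Matrix (Fin k) (Fin k) ℝ)).mulVec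
      (WithLp.ofLp (√k • t)) = ‖t‖ ^ 2 := by
    rw [Matrix.smul_mulVec, Matrix.one_mulVec, dotProduct_smul, WithLp.ofLp_smul, smul_dotProduct,
      dotProduct_smul, EuclideanSpace.real_norm_sq_eq]
    simp only [smul_eq_mul, dotProduct, ← pow_two]
    rw [← mul_assoc √k, Real.mul_self_sqrt hk'.le, ← mul_assoc, inv_mul_cancel₀ hk'.ne', one_mul]
  rw [h]
  simp [neg_div]

/-- The rows of the hidden-layer design matrix, as vectors. -/
def rowsW {m n k : ℕ} (x : Fin n → EuclideanSpace ℝ (Fin (m * k))) (r : Fin k) :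
    EuclideanSpace ℝ (Fin m × Fin n) :=
  WithLp.toLp 2 (designW x r)

lemma rowsW_apply {m n k : ℕ} (x : Fin n → EuclideanSpace ℝ (Fin (m * k))) (r : Fin k)
    (q : Fin m × Fin n) : rowsW x r q = x q.2 (finProdFinEquiv (q.1, r)) :=
  patchMatrix_mulVec _ _ _

lemma measurable_rowsW {m n k : ℕ} :
    Measurable (rowsW : (Fin n → EuclideanSpace ℝ (Fin (m * k))) → _) := by
  refine measurable_pi_lambda _ fun r => ?_
  refine (PiLp.continuous_toLp 2 _).measurable.comp (measurable_pi_lambda _ fun q => ?_)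
  have : (fun x : Fin n → EuclideanSpace ℝ (Fin (m * k)) => designW x r q) =
      fun x => x q.2 (finProdFinEquiv (q.1, r)) := by
    ext x; exact rowsW_apply x r q
  rw [this]
  fun_prop

/-- The hidden-layer design matrix of Gaussian inputs has independent standard Gaussian rows. -/
lemma map_rowsW {m n k : ℕ} :
    (Measure.pi fun _ : Fin n => stdGaussian (EuclideanSpace ℝ (Fin (m * k)))).map rowsW =
      Measure.pi fun _ : Fin k => stdGaussian (EuclideanSpace ℝ (Fin m × Fin n)) := by
  rw [← charFun_eq_pi_iff]
  intro t
  -- `τ` holds the coordinates of `t` rearranged as inputs. Rearranging preserves inner products and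
  -- norms, and the Gaussian characteristic function depends on the norm alone.
  let τ : PiLp 2 fun _ : Fin n => EuclideanSpace ℝ (Fin (m * k)) :=
    WithLp.toLp 2 fun s => WithLp.toLp 2 fun c =>
      t (finProdFinEquiv.symm c).2 ((finProdFinEquiv.symm c).1, s)
  have hinner : ∀ x, inner ℝ (WithLp.toLp 2 (rowsW x)) t = inner ℝ (WithLp.toLp 2 x) τ := fun x => by
    simp only [PiLp.inner_apply, rowsW_apply, τ, ← finProdFinEquiv.sum_comp,
      Equiv.symm_apply_apply, Fintype.sum_prod_type]
    rw [Finset.sum_comm]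
    conv_rhs => rw [Finset.sum_comm]
    refine Finset.sum_congr rfl fun i _ => ?_
    rw [Finset.sum_comm]
  have hnorm : ∑ r, ‖t r‖ ^ 2 = ∑ s, ‖τ s‖ ^ 2 := by
    simp only [EuclideanSpace.real_norm_sq_eq, τ, ← finProdFinEquiv.sum_comp,
      Equiv.symm_apply_apply, Fintype.sum_prod_type]
    rw [Finset.sum_comm]
    conv_rhs => rw [Finset.sum_comm]
    refine Finset.sum_congr rfl fun i _ => ?_
    rw [Finset.sum_comm]
  have hleft : charFun (((Measure.pi fun _ : Fin n =>
        stdGaussian (EuclideanSpace ℝ (Fin (m * k)))).map rowsW).map (WithLp.toLp 2)) t =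
      charFun ((Measure.pi fun _ : Fin n =>
        stdGaussian (EuclideanSpace ℝ (Fin (m * k)))).map (WithLp.toLp 2)) τ := by
    rw [charFun_apply, charFun_apply, integral_map (by fun_prop) (by fun_prop),
      integral_map (measurable_rowsW.aemeasurable) (by fun_prop),
      integral_map (by fun_prop) (by fun_prop)]
    simp_rw [hinner]
  rw [hleft, charFun_pi]
  simp_rw [charFun_stdGaussian]
  rw [← Complex.exp_sum, ← Complex.exp_sum]
  congr 1
  rw [← Finset.sum_div, ← Finset.sum_div, Finset.sum_neg_distrib, Finset.sum_neg_distrib]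
  congr 2
  exact_mod_cast hnorm.symm

/-! ### Exponential moments of Gaussian quadratic forms -/

section StandardGaussian

variable {E : Type*} [NormedAddCommGroup E] [InnerProductSpace ℝ E] [FiniteDimensional ℝ E]
  [MeasurableSpace E] [BorelSpace E]

lemma lintegral_comp_inner_stdGaussian {a : E} (ha : ‖a‖ = 1) {f : ℝ → ENNReal}
    (hf : Measurable f) :
    ∫⁻ g, f (inner ℝ g a) ∂(stdGaussian E) = ∫⁻ x, f x ∂(gaussianReal 0 1) := by
  rw [← map_inner_stdGaussian ha, lintegral_map hf (by fun_prop)]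

/-- The exponential moment of a Gaussian quadratic form is controlled by that of a squared standard
normal variable, by convexity. -/
lemma lintegral_exp_sum_inner_sq_le {C K : ℝ} (hC : 0 ≤ C) (hK1 : 1 ≤ K)
    (hK : ∫⁻ x, ENNReal.ofReal (Real.exp (C * x ^ 2)) ∂(gaussianReal 0 1) ≤ ENNReal.ofReal K)
    {α : Type*} [Fintype α] (u : α → E) {V : ℝ} (hV : ∑ a, ‖u a‖ ^ 2 ≤ V) :
    ∫⁻ g, ENNReal.ofReal (Real.exp (C / V * ∑ a, inner ℝ g (u a) ^ 2)) ∂(stdGaussian E) ≤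
      ENNReal.ofReal K := by
  have hunit : ∀ a, ∫⁻ g, ENNReal.ofReal (Real.exp (C * inner ℝ g (‖u a‖⁻¹ • u a) ^ 2))
      ∂(stdGaussian E) ≤ ENNReal.ofReal K := by
    intro a
    rcases eq_or_ne (u a) 0 with h | h
    · simpa [h] using hK1
    · have hn : ‖‖u a‖⁻¹ • u a‖ = 1 := norm_smul_inv_norm (𝕜 := ℝ) h
      rw [lintegral_comp_inner_stdGaussian
        (f := fun x => ENNReal.ofReal (Real.exp (C * x ^ 2))) hn (by fun_prop)]
      exact hK
  have hterm : ∀ g a, inner ℝ g (u a) ^ 2 = ‖u a‖ ^ 2 * inner ℝ g (‖u a‖⁻¹ • u a) ^ 2 := by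
    intro g a
    rcases eq_or_ne (u a) 0 with h | h
    · simp [h]
    · have : ‖u a‖ ≠ 0 := norm_ne_zero_iff.2 h
      rw [real_inner_smul_right]
      field_simp
  have hW0 : 0 ≤ ∑ a, ‖u a‖ ^ 2 := by positivity
  rcases hW0.eq_or_lt with hW | hW
  · have hz : ∀ a, u a = 0 := fun a => by
      have := (Finset.sum_eq_zero_iff_of_nonneg (fun a _ => sq_nonneg ‖u a‖)).1 hW.symm a
        (Finset.mem_univ a)
      simpa using this
    simpa [hz] using hK1
  set W := ∑ a, ‖u a‖ ^ 2 with hWdef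
  have hweights : ∑ a, ‖u a‖ ^ 2 / W = 1 := by rw [← Finset.sum_div, div_self hW.ne']
  -- Jensen's inequality with weights `‖u a‖² / W`; since `W ≤ V`, replacing `V` by `W` only
  -- increases the exponent.
  have hpt : ∀ g, Real.exp (C / V * ∑ a, inner ℝ g (u a) ^ 2) ≤
      ∑ a, ‖u a‖ ^ 2 / W * Real.exp (C * inner ℝ g (‖u a‖⁻¹ • u a) ^ 2) := by
    intro g
    calc _ ≤ Real.exp (C / W * ∑ a, inner ℝ g (u a) ^ 2) := by gcongr
      _ = Real.exp (∑ a, (‖u a‖ ^ 2 / W) • (C * inner ℝ g (‖u a‖⁻¹ • u a) ^ 2)) := by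
          congr 1
          rw [Finset.mul_sum]
          refine Finset.sum_congr rfl fun a _ => ?_
          rw [hterm, smul_eq_mul]
          ring
      _ ≤ _ := convexOn_exp.map_sum_le (fun a _ => by positivity) hweights (by simp)
  calc _ ≤ ∫⁻ g, ∑ a, ENNReal.ofReal (‖u a‖ ^ 2 / W) *
          ENNReal.ofReal (Real.exp (C * inner ℝ g (‖u a‖⁻¹ • u a) ^ 2)) ∂(stdGaussian E) := by
        refine lintegral_mono fun g => (ENNReal.ofReal_le_ofReal (hpt g)).trans ?_
        rw [ENNReal.ofReal_sum_of_nonneg fun a _ => by positivity]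
        refine Finset.sum_le_sum fun a _ => ?_
        rw [ENNReal.ofReal_mul (by positivity)]
    _ = ∑ a, ENNReal.ofReal (‖u a‖ ^ 2 / W) *
          ∫⁻ g, ENNReal.ofReal (Real.exp (C * inner ℝ g (‖u a‖⁻¹ • u a) ^ 2)) ∂(stdGaussian E) := by
        rw [lintegral_finsetSum _ (by fun_prop)]
        refine Finset.sum_congr rfl fun a _ => lintegral_const_mul _ (by fun_prop)
    _ ≤ ∑ a, ENNReal.ofReal (‖u a‖ ^ 2 / W) * ENNReal.ofReal K := by
        gcongr with a
        exact hunit a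
    _ = ENNReal.ofReal K := by
        rw [← Finset.sum_mul, ← ENNReal.ofReal_sum_of_nonneg fun a _ => by positivity, hweights]
        simp

end StandardGaussian

/-! ### Gaussian row matrices: from nets to the sphere -/

/-- Moving to a net point costs at most `‖T‖ / 2`, which is absorbed into the left side. -/
lemma norm_le_of_sphere_net {E G : Type*} [NormedAddCommGroup E] [NormedSpace ℝ E]
    [NormedAddCommGroup G] [NormedSpace ℝ G] (T : E →L[ℝ] G) {S : Set E}
    (hS : ∀ x : E, ‖x‖ = 1 → ∃ y ∈ S, ‖x - y‖ ≤ 1 / 2) {M : ℝ} (hM0 : 0 ≤ M)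
    (hM : ∀ y ∈ S, ‖T y‖ ≤ M) : ‖T‖ ≤ 2 * M := by
  have : ‖T‖ ≤ M + ‖T‖ * (1 / 2) := by
    refine T.opNorm_le_of_unit_norm (by positivity) fun x hx => ?_
    obtain ⟨y, hy, hxy⟩ := hS x hx
    calc ‖T x‖ = ‖T y + T (x - y)‖ := by rw [← map_add]; congr 2; abel
      _ ≤ ‖T y‖ + ‖T (x - y)‖ := norm_add_le _ _
      _ ≤ M + ‖T‖ * (1 / 2) :=
        add_le_add (hM y hy) ((T.le_opNorm _).trans (by gcongr))
  linarith

lemma sum_abs_le_sqrt_mul_norm {k : ℕ} (v : EuclideanSpace ℝ (Fin k)) :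
    ∑ r, |v r| ≤ √k * ‖v‖ := by
  have h := sq_sum_le_card_mul_sum_sq (s := Finset.univ) (f := fun r => |v r|)
  simp only [sq_abs, Finset.card_univ, Fintype.card_fin, ← EuclideanSpace.real_norm_sq_eq] at h
  calc ∑ r, |v r| ≤ √(k * ‖v‖ ^ 2) := Real.le_sqrt_of_sq_le h
    _ = _ := by rw [Real.sqrt_mul (by positivity), Real.sqrt_sq (norm_nonneg _)]

/-- From `exp(-y) ≤ 1 / y`. The dimension is at least one, so a small ratio to the sample size
forces a large sample size and hence a small failure probability. -/
lemma exp_neg_mul_le_of_mul_le {c δ κ x : ℝ} (hc : 0 < c) (hκ : κ ≤ c * δ) (hx : 1 ≤ κ * x)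
    (hx0 : 0 < x) : Real.exp (-(c * x)) ≤ δ := by
  have h1 : c * x ≤ Real.exp (c * x) := (by linarith : c * x ≤ c * x + 1).trans (Real.add_one_le_exp _)
  have h2 : 1 ≤ δ * (c * x) := by nlinarith
  have hδ : 0 < δ := by
    by_contra! h
    nlinarith [mul_pos hc hx0]
  rw [Real.exp_neg, inv_le_comm₀ (Real.exp_pos _) hδ]
  refine le_trans ?_ h1
  rw [inv_le_iff_one_le_mul₀ hδ]
  linarith

/-- The matrix whose rows are the `R r`, restricted to a subspace, is bounded above and below as
soon as it is so on nets. -/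
lemma bounds_of_sphere_nets {E F : Type*} [NormedAddCommGroup E] [InnerProductSpace ℝ E]
    [FiniteDimensional ℝ E] [NormedAddCommGroup F] [InnerProductSpace ℝ F] (V : E →ₗᵢ[ℝ] F)
    {k : ℕ} (hk : 1 ≤ k) (R : Fin k → F) {S₁ S₂ : Set E} {T Λ lam : ℝ} (hΛ : 0 < Λ)
    (hT : 4 * T = Λ ^ 2)
    (hS₁ : ∀ x : E, ‖x‖ = 1 → ∃ y ∈ S₁, ‖x - y‖ ≤ 1 / 2)
    (hS₂ : ∀ x : E, ‖x‖ = 1 → ∃ y ∈ S₂, ‖x - y‖ ≤ lam / Λ)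
    (h₁ : ∀ y ∈ S₁, ∑ r, inner ℝ (R r) (V y) ^ 2 ≤ T * k)
    (h₂ : ∀ y ∈ S₂, 2 * lam * k ≤ ∑ r, |inner ℝ (R r) (V y)|) :
    ∀ Δ : E, ‖Δ‖ = 1 → lam ≤ (1 / (k : ℝ)) * ∑ r, |inner ℝ (R r) (V Δ)| ∧
      (1 / (k : ℝ)) * ∑ r, |inner ℝ (R r) (V Δ)| ^ 2 ≤ Λ ^ 2 := by
  have hk0 : (0 : ℝ) < k := by exact_mod_cast hk
  let A : E →L[ℝ] EuclideanSpace ℝ (Fin k) :=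
    ((PiLp.continuousLinearEquiv 2 ℝ fun _ : Fin k => ℝ).symm : (Fin k → ℝ) →L[ℝ] _) ∘L
      ContinuousLinearMap.pi fun r => (innerSL ℝ (R r)) ∘L V.toContinuousLinearMap
  have hA : ∀ x r, A x r = inner ℝ (R r) (V x) := fun x r => rfl
  have hAnorm : ∀ x, ‖A x‖ ^ 2 = ∑ r, inner ℝ (R r) (V x) ^ 2 := fun x => by
    rw [EuclideanSpace.real_norm_sq_eq]; rfl
  -- The relation `4 T = Λ²` absorbs the factor `2` lost in `norm_le_of_sphere_net`.
  have hop : ‖A‖ ≤ Λ * √k := by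
    have := norm_le_of_sphere_net A hS₁ (M := Λ * √k / 2) (by positivity) fun y hy => by
      refine abs_le_of_sq_le_sq' ?_ (by positivity) |>.2
      rw [hAnorm, div_pow, mul_pow, Real.sq_sqrt hk0.le, ← hT]
      linarith [h₁ y hy]
    linarith
  intro Δ hΔ
  constructor
  · obtain ⟨y, hy, hΔy⟩ := hS₂ Δ hΔ
    -- The mesh `lam / Λ` is chosen so that the average moves by at most `lam`, half of the bound
    -- available on the net.
    have hdiff : ∑ r, |inner ℝ (R r) (V (Δ - y))| ≤ lam * k := by
      calc _ = ∑ r, |A (Δ - y) r| := rfl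
        _ ≤ √k * ‖A (Δ - y)‖ := sum_abs_le_sqrt_mul_norm _
        _ ≤ √k * (Λ * √k * (lam / Λ)) := by
          gcongr
          exact (A.le_opNorm _).trans (by gcongr)
        _ = lam * (√k * √k) := by field_simp
        _ = lam * k := by rw [Real.mul_self_sqrt hk0.le]
    have htri : ∑ r, |inner ℝ (R r) (V y)| ≤
        ∑ r, |inner ℝ (R r) (V Δ)| + ∑ r, |inner ℝ (R r) (V (Δ - y))| := by
      rw [← Finset.sum_add_distrib]
      refine Finset.sum_le_sum fun r _ => ?_
      have : inner ℝ (R r) (V y) = inner ℝ (R r) (V Δ) - inner ℝ (R r) (V (Δ - y)) := by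
        rw [map_sub, inner_sub_right]; ring
      rw [this]
      exact abs_sub _ _
    rw [one_div, inv_mul_eq_div, le_div_iff₀ hk0]
    linarith [h₂ y hy]
  · simp only [sq_abs]
    rw [← hAnorm, one_div, inv_mul_eq_div, div_le_iff₀ hk0]
    have := A.le_opNorm Δ
    rw [hΔ, mul_one] at this
    calc ‖A Δ‖ ^ 2 ≤ (Λ * √k) ^ 2 := by gcongr; exact this.trans hop
      _ = _ := by rw [mul_pow, Real.sq_sqrt hk0.le]

lemma measureReal_biUnion_finset_le_card_mul {Ω ι : Type*} [MeasurableSpace Ω] (P : Measure Ω)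
    (S : Finset ι) (B : ι → Set Ω) {b c : ℝ} (hb : 0 ≤ b) (hc : (S.card : ℝ) ≤ c)
    (hB : ∀ i ∈ S, P.real (B i) ≤ b) : P.real (⋃ i ∈ S, B i) ≤ c * b :=
  calc _ ≤ ∑ i ∈ S, P.real (B i) := measureReal_biUnion_finset_le _ _
    _ ≤ ∑ _i ∈ S, b := Finset.sum_le_sum hB
    _ = S.card * b := by simp
    _ ≤ c * b := by gcongr

/-- The threshold `(1 + log K) / C` is the one that makes each Chernoff factor `exp(-1)`. -/
lemma exp_neg_mul_mul_eq_exp_neg_one {C K : ℝ} (hC : 0 < C) (hK : 1 ≤ K) :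
    Real.exp (-(C * ((1 + Real.log K) / C))) * K = Real.exp (-1) := by
  have hK0 : 0 < K := by linarith
  rw [mul_div_cancel₀ _ hC.ne']
  nth_rewrite 2 [← Real.exp_log hK0]
  rw [← Real.exp_add]
  congr 1
  ring

/-- Half of the available decay goes into the threshold, leaving a Chernoff factor `√ρ < 1` when `ρ
< 1`. -/
lemma exp_neg_mul_eq_exp_neg {ρ : ℝ} (hρ : 0 < ρ) :
    Real.exp (-(Real.log ρ / 2)) * ρ = Real.exp (-(-Real.log ρ / 2)) := by
  nth_rewrite 2 [← Real.exp_log hρ]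
  rw [← Real.exp_add]
  congr 1
  ring

/-- A `k`-row matrix with independent standard Gaussian rows, restricted to a subspace of dimension
at most `κ k`, is bounded above and below with high probability. -/
theorem exists_gaussian_rows_bounds :
    ∃ lam Λ : ℝ, 0 < lam ∧ 0 < Λ ∧ ∀ δ : ℝ, 0 < δ → ∃ κ : ℝ, 0 < κ ∧
      ∀ {E F : Type} [NormedAddCommGroup E] [InnerProductSpace ℝ E] [FiniteDimensional ℝ E]
        [NormedAddCommGroup F] [InnerProductSpace ℝ F] [FiniteDimensional ℝ F]
        [MeasurableSpace F] [BorelSpace F] (V : E →ₗᵢ[ℝ] F) (k : ℕ), 1 ≤ k →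
        (Module.finrank ℝ E : ℝ) ≤ κ * k → 1 ≤ κ * k →
        (Measure.pi fun _ : Fin k => stdGaussian F).real
          {R | ¬ ∀ Δ : E, ‖Δ‖ = 1 → lam ≤ (1 / (k : ℝ)) * ∑ r, |inner ℝ (R r) (V Δ)| ∧
            (1 / (k : ℝ)) * ∑ r, |inner ℝ (R r) (V Δ)| ^ 2 ≤ Λ ^ 2} ≤ δ := by
  obtain ⟨C, K, hC, hK1, hK⟩ := exists_lintegral_exp_mul_sq_gaussianReal_le
  obtain ⟨ρ, hρ0, hρ1, hρ⟩ := exists_lintegral_exp_neg_abs_gaussianReal_le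
  set T := (1 + Real.log K) / C with hTdef
  have hT : 0 < T := by have := Real.log_nonneg hK1; positivity
  set l := -Real.log ρ / 2 with hldef
  have hl : 0 < l := by have := Real.log_neg hρ0 hρ1; rw [hldef]; linarith
  set lam := l / 2 with hlam
  have hlam0 : 0 < lam := by positivity
  set Λ := 2 * √T with hΛdef
  have hΛ : 0 < Λ := by positivity
  have hTΛ : 4 * T = Λ ^ 2 := by rw [hΛdef, mul_pow, Real.sq_sqrt hT.le]; norm_num
  refine ⟨lam, Λ, hlam0, hΛ, fun δ hδ => ?_⟩
  set ε := lam / Λ with hε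
  have hε0 : 0 < ε := by positivity
  -- The first two entries keep each net's exponent below half the Chernoff exponent; the last two
  -- make each remaining exponential at most `δ / 2`.
  set κ := min (min (1 / 8) (l * ε / 4)) (min (1 / 2 * (δ / 2)) (l / 2 * (δ / 2))) with hκ
  have hκ0 : 0 < κ := by positivity
  have hκ1 : κ ≤ 1 / 8 := (min_le_left _ _).trans (min_le_left _ _)
  have hκ2 : κ ≤ l * ε / 4 := (min_le_left _ _).trans (min_le_right _ _)
  have hκ3 : κ ≤ 1 / 2 * (δ / 2) := (min_le_right _ _).trans (min_le_left _ _)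
  have hκ4 : κ ≤ l / 2 * (δ / 2) := (min_le_right _ _).trans (min_le_right _ _)
  refine ⟨κ, hκ0, fun {E F} => ?_⟩
  intro _ _ _ _ _ _ _ _ V k hk hfin hκk
  have hk0 : (0 : ℝ) < k := by exact_mod_cast hk
  obtain ⟨S₁, hS₁, hcard₁, hnet₁⟩ := exists_sphere_net (E := E) (ε := 1 / 2) (by norm_num)
  obtain ⟨S₂, hS₂, hcard₂, hnet₂⟩ := exists_sphere_net (E := E) hε0
  set P := Measure.pi fun _ : Fin k => stdGaussian F
  have hsub : {R : Fin k → F | ¬ ∀ Δ : E, ‖Δ‖ = 1 →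
      lam ≤ (1 / (k : ℝ)) * ∑ r, |inner ℝ (R r) (V Δ)| ∧
        (1 / (k : ℝ)) * ∑ r, |inner ℝ (R r) (V Δ)| ^ 2 ≤ Λ ^ 2} ⊆
      (⋃ y ∈ S₁, {R | C * T * k ≤ ∑ r, C * inner ℝ (R r) (V y) ^ 2}) ∪
        ⋃ y ∈ S₂, {R | Real.log ρ / 2 * k ≤ ∑ r, -|inner ℝ (R r) (V y)|} := by
    intro R hR
    by_contra hR'
    simp only [Set.mem_union, Set.mem_iUnion, not_or, not_exists, Set.mem_ofPred_eq, not_le] at hR'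
    refine hR (bounds_of_sphere_nets V hk R hΛ hTΛ hnet₁ hnet₂ (fun y hy => ?_) fun y hy => ?_)
    · have := hR'.1 y hy
      rw [← Finset.mul_sum, mul_assoc] at this
      exact (lt_of_mul_lt_mul_left this hC.le).le
    · have := hR'.2 y hy
      rw [Finset.sum_neg_distrib] at this
      rw [hlam, hldef]
      linarith
  have hprob₁ : ∀ y ∈ S₁, P.real {R | C * T * k ≤ ∑ r, C * inner ℝ (R r) (V y) ^ 2} ≤
      Real.exp (-k) := fun y hy => by
    have hVy : ‖V y‖ = 1 := by rw [V.norm_map, hS₁ y hy]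
    refine (measureReal_le_sum_le_of_lintegral_exp_le (stdGaussian F)
      (f := fun g => C * inner ℝ g (V y) ^ 2) (by fun_prop) (K := K) ?_ (by linarith) k
      (C * T)).trans_eq ?_
    · rw [lintegral_comp_inner_stdGaussian
        (f := fun x => ENNReal.ofReal (Real.exp (C * x ^ 2))) hVy (by fun_prop)]
      exact hK
    · rw [hTdef, exp_neg_mul_mul_eq_exp_neg_one hC hK1, ← Real.exp_nat_mul]
      simp
  have hprob₂ : ∀ y ∈ S₂, P.real {R | Real.log ρ / 2 * k ≤ ∑ r, -|inner ℝ (R r) (V y)|} ≤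
      Real.exp (-(l * k)) := fun y hy => by
    have hVy : ‖V y‖ = 1 := by rw [V.norm_map, hS₂ y hy]
    refine (measureReal_le_sum_le_of_lintegral_exp_le (stdGaussian F)
      (f := fun g => -|inner ℝ g (V y)|) (by fun_prop) (K := ρ) ?_ hρ0.le k _).trans_eq ?_
    · rw [lintegral_comp_inner_stdGaussian
        (f := fun x => ENNReal.ofReal (Real.exp (-|x|))) hVy (by fun_prop)]
      exact hρ
    · rw [exp_neg_mul_eq_exp_neg hρ0, ← Real.exp_nat_mul]
      congr 1
      rw [hldef]
      ring
  calc _ ≤ _ := measureReal_mono hsub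
    _ ≤ _ := measureReal_union_le _ _
    _ ≤ Real.exp (2 * Module.finrank ℝ E / (1 / 2)) * Real.exp (-k) +
        Real.exp (2 * Module.finrank ℝ E / ε) * Real.exp (-(l * k)) :=
      add_le_add
        (measureReal_biUnion_finset_le_card_mul P S₁ _ (Real.exp_pos _).le hcard₁ hprob₁)
        (measureReal_biUnion_finset_le_card_mul P S₂ _ (Real.exp_pos _).le hcard₂ hprob₂)
    _ ≤ Real.exp (-(1 / 2 * k)) + Real.exp (-(l / 2 * k)) := by
      rw [← Real.exp_add, ← Real.exp_add]
      refine add_le_add (Real.exp_le_exp.2 ?_) (Real.exp_le_exp.2 ?_)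
      · nlinarith
      · have h1 : 2 * (Module.finrank ℝ E : ℝ) / ε ≤ l / 2 * k := by
          rw [div_le_iff₀ hε0]
          nlinarith
        linarith
    _ ≤ δ / 2 + δ / 2 := add_le_add
      (exp_neg_mul_le_of_mul_le (by norm_num) hκ3 hκk hk0)
      (exp_neg_mul_le_of_mul_le (by positivity) hκ4 hκk hk0)
    _ = δ := by ring

/-! ### Transfer of probabilities and measurability -/

/-- This direction of the inequality holds for arbitrary sets, so `p` need not be measurable. -/
lemma measureReal_le_of_hasLaw {Ω 𝓧 : Type*} [MeasurableSpace Ω] [MeasurableSpace 𝓧] {X : Ω → 𝓧}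
    {μ : Measure 𝓧} {P : Measure Ω} [IsFiniteMeasure μ] (hX : HasLaw X μ P) (p : 𝓧 → Prop) :
    P.real {ω | p (X ω)} ≤ μ.real {x | p x} := by
  refine ENNReal.toReal_mono (measure_ne_top _ _) ?_
  rw [← hX.map_eq]
  exact Measure.le_map_apply hX.aemeasurable _

lemma one_sub_le_measureReal_of_not_le {Ω : Type*} [MeasurableSpace Ω] (P : Measure Ω)
    [IsProbabilityMeasure P] {p : Ω → Prop} {δ : ℝ} (h : P.real {ω | ¬ p ω} ≤ δ) :
    1 - δ ≤ P.real {ω | p ω} := by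
  have h1 := measureReal_union_le (μ := P) {ω | p ω} {ω | ¬ p ω}
  have h2 : {ω | p ω} ∪ {ω | ¬ p ω} = Set.univ := by
    ext ω; simpa using em (p ω)
  rw [h2, probReal_univ] at h1
  linarith

/-- Fubini, with conditional probability at most `1` over `B` and at most `ε` elsewhere. As `B` may
fail to be measurable, its measurable hull replaces it. -/
lemma measureReal_prod_le {α β : Type*} [MeasurableSpace α] [MeasurableSpace β] (μ : Measure α)
    (ν : Measure β) [IsProbabilityMeasure μ] [IsProbabilityMeasure ν] {S : Set (α × β)}
    (hS : MeasurableSet S) {B : Set α} {ε : ℝ} (hε : 0 ≤ ε)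
    (h : ∀ x ∉ B, ν.real (Prod.mk x ⁻¹' S) ≤ ε) : (μ.prod ν).real S ≤ μ.real B + ε := by
  have key : (μ.prod ν) S ≤ μ B + ENNReal.ofReal ε := by
    rw [Measure.prod_apply hS]
    calc _ ≤ ∫⁻ x, ((toMeasurable μ B).indicator 1 x + ENNReal.ofReal ε) ∂μ := by
          refine lintegral_mono fun x => ?_
          by_cases hx : x ∈ B
          · rw [Set.indicator_of_mem (subset_toMeasurable μ B hx)]
            exact prob_le_one.trans (by simp)
          · refine le_add_left ?_
            rw [← ENNReal.ofReal_toReal (measure_ne_top ν _)]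
            exact ENNReal.ofReal_le_ofReal (h x hx)
      _ = μ B + ENNReal.ofReal ε := by
          rw [lintegral_add_right _ measurable_const, lintegral_indicator_one
            (measurableSet_toMeasurable _ _), measure_toMeasurable]
          simp
  refine (ENNReal.toReal_mono (by finiteness) key).trans_eq ?_
  rw [ENNReal.toReal_add (by finiteness) (by finiteness), ENNReal.toReal_ofReal hε]
  rfl

/-- Provides the measurability needed for Fubini: the conditions involve uncountably many `Δ`, and
closed sets survive such intersections. -/
lemma isClosed_designConditions {X ι : Type*} [TopologicalSpace X] [Fintype ι] {N : ℕ}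
    {A : X → Matrix (Fin N) ι ℝ} (hA : ∀ i t, Continuous fun x => A x i t) (c : Fin N → ℝ)
    (σsq lamLow lamHighSq : ℝ) :
    IsClosed {x | DesignConditions (A x) c σsq lamLow lamHighSq} := by
  have hrow : ∀ i, Continuous fun x => (WithLp.toLp 2 (A x i) : EuclideanSpace ℝ ι) := fun i =>
    (PiLp.continuous_toLp 2 _).comp (continuous_pi fun t => hA i t)
  refine IsClosed.and ?_ (IsClosed.and ?_ ?_)
  · exact isClosed_le (by fun_prop) continuous_const
  · simp only [SmallBallLowerBound, Set.ofPred_forall]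
    exact isClosed_iInter fun Δ => isClosed_iInter fun _ =>
      isClosed_le continuous_const (by fun_prop)
  · simp only [QuadraticUpperBound, Set.ofPred_forall]
    exact isClosed_iInter fun Δ => isClosed_iInter fun _ =>
      isClosed_le (by fun_prop) continuous_const

/-! ### Weighted averages and the hidden layer -/

lemma integral_sq_sum_mul_inner {F : Type*} [NormedAddCommGroup F] [InnerProductSpace ℝ F]
    [FiniteDimensional ℝ F] [MeasurableSpace F] [BorelSpace F] {k : ℕ} (c : Fin k → ℝ) {a : F}
    (ha : ‖a‖ = 1) :
    Integrable (fun R : Fin k → F => (∑ r, c r * inner ℝ (R r) a) ^ 2)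
        (Measure.pi fun _ => stdGaussian F) ∧
      ∫ R, (∑ r, c r * inner ℝ (R r) a) ^ 2 ∂(Measure.pi fun _ : Fin k => stdGaussian F) =
        ∑ r, c r ^ 2 := by
  have hL : MemLp (fun g : F => inner ℝ g a) 2 (stdGaussian F) := by
    have : MemLp id 2 (gaussianReal 0 1) := IsGaussian.memLp_two_id
    rw [← map_inner_stdGaussian ha] at this
    exact this.comp_of_map (by fun_prop)
  have hmean : ∫ g, inner ℝ g a ∂(stdGaussian F) = 0 := by
    have : ∫ x, x ∂(gaussianReal 0 1) = 0 := integral_id_gaussianReal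
    rwa [← map_inner_stdGaussian ha, integral_map (by fun_prop) (by fun_prop)] at this
  have hvar : Var[fun g : F => inner ℝ g a; stdGaussian F] = 1 := by
    have : Var[id; gaussianReal 0 1] = 1 := by simp
    rwa [← map_inner_stdGaussian ha, variance_map (by fun_prop) (by fun_prop)] at this
  have hLc : ∀ r, MemLp (fun g : F => c r * inner ℝ g a) 2 (stdGaussian F) :=
    fun r => hL.const_mul _
  have hLr : ∀ r, MemLp (fun R : Fin k → F => c r * inner ℝ (R r) a) 2
      (Measure.pi fun _ => stdGaussian F) := fun r =>
    (hLc r).comp_measurePreserving (measurePreserving_eval (fun _ : Fin k => stdGaussian F) r)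
  have hsum : MemLp (fun R : Fin k → F => ∑ r, c r * inner ℝ (R r) a) 2
      (Measure.pi fun _ => stdGaussian F) := memLp_finsetSum _ fun r _ => hLr r
  refine ⟨hsum.integrable_sq, ?_⟩
  have hzero : ∫ R, ∑ r, c r * inner ℝ (R r) a ∂(Measure.pi fun _ : Fin k => stdGaussian F) = 0 := by
    rw [integral_finsetSum _ fun r _ => (hLr r).integrable (by norm_num)]
    refine Finset.sum_eq_zero fun r _ => ?_
    rw [integral_const_mul, integral_comp_eval (μ := fun _ : Fin k => stdGaussian F) (i := r)
      (f := fun g => inner ℝ g a) (by fun_prop), hmean, mul_zero]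
  rw [← variance_of_integral_eq_zero hsum.aemeasurable hzero]
  have := variance_sum_pi (μ := fun _ : Fin k => stdGaussian F)
    (X := fun r g => c r * inner ℝ g a) hLc
  have he : (∑ r, fun R : Fin k → F => c r * inner ℝ (R r) a) =
      fun R => ∑ r, c r * inner ℝ (R r) a := by ext R; simp
  rw [he] at this
  rw [this]
  refine Finset.sum_congr rfl fun r _ => ?_
  rw [variance_const_mul, hvar, mul_one]

/-- Summing the second moments over coordinates gives mean at most `card ι / k`; then Markov's
inequality applies. -/
lemma measureReal_weighted_average_gt_le {ι : Type*} [Fintype ι] [Nonempty ι] {k : ℕ}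
    (hk : 1 ≤ k) {c : Fin k → ℝ} (hc : ∀ r, |c r| ≤ 1) {σsq : ℝ} (hσ : 0 < σsq) :
    (Measure.pi fun _ : Fin k => stdGaussian (EuclideanSpace ℝ ι)).real
      {R | ¬ ‖(1 / (k : ℝ)) • ∑ r, c r • R r‖ ^ 2 ≤ σsq * (Fintype.card ι : ℝ) / (k : ℝ)} ≤
      1 / σsq := by
  classical
  have hk0 : (0 : ℝ) < k := by exact_mod_cast hk
  have hι : (0 : ℝ) < Fintype.card ι := by exact_mod_cast Fintype.card_pos
  have hunit : ∀ q : ι, ‖EuclideanSpace.single q (1 : ℝ)‖ = 1 := fun q => by simp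
  have hf : (fun R : Fin k → EuclideanSpace ℝ ι => ‖(1 / (k : ℝ)) • ∑ r, c r • R r‖ ^ 2) =
      fun R => (1 / (k : ℝ)) ^ 2 *
        ∑ q, (∑ r, c r * inner ℝ (R r) (EuclideanSpace.single q (1 : ℝ))) ^ 2 := by
    ext R
    rw [norm_smul, mul_pow, EuclideanSpace.real_norm_sq_eq]
    simp [EuclideanSpace.inner_single_right]
  have hint : Integrable (fun R : Fin k → EuclideanSpace ℝ ι =>
      ‖(1 / (k : ℝ)) • ∑ r, c r • R r‖ ^ 2) (Measure.pi fun _ => stdGaussian _) := by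
    rw [hf]
    exact (integrable_finsetSum _ fun q _ => (integral_sq_sum_mul_inner c (hunit q)).1).const_mul _
  have hval : ∫ R, ‖(1 / (k : ℝ)) • ∑ r, c r • R r‖ ^ 2
      ∂(Measure.pi fun _ : Fin k => stdGaussian (EuclideanSpace ℝ ι)) ≤ Fintype.card ι / k := by
    rw [hf, integral_const_mul,
      integral_finsetSum _ fun q _ => (integral_sq_sum_mul_inner c (hunit q)).1]
    simp_rw [fun q => (integral_sq_sum_mul_inner c (hunit q)).2]
    have hc2 : ∑ r, c r ^ 2 ≤ k := by
      calc ∑ r, c r ^ 2 ≤ ∑ _r : Fin k, (1 : ℝ) :=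
            Finset.sum_le_sum fun r _ => (sq_le_one_iff_abs_le_one _).2 (hc r)
        _ = k := by simp
    rw [Finset.sum_const, Finset.card_univ, nsmul_eq_mul]
    calc _ ≤ (1 / (k : ℝ)) ^ 2 * (Fintype.card ι * k) := by gcongr
      _ = _ := by field_simp
  have hmarkov := mul_meas_ge_le_integral_of_nonneg
    (μ := Measure.pi fun _ : Fin k => stdGaussian (EuclideanSpace ℝ ι))
    (.of_forall fun R => by positivity) hint (σsq * (Fintype.card ι : ℝ) / (k : ℝ))
  have hmono : (Measure.pi fun _ : Fin k => stdGaussian (EuclideanSpace ℝ ι)).real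
      {R | ¬ ‖(1 / (k : ℝ)) • ∑ r, c r • R r‖ ^ 2 ≤ σsq * (Fintype.card ι : ℝ) / (k : ℝ)} ≤
      (Measure.pi fun _ : Fin k => stdGaussian (EuclideanSpace ℝ ι)).real
      {R | σsq * (Fintype.card ι : ℝ) / (k : ℝ) ≤ ‖(1 / (k : ℝ)) • ∑ r, c r • R r‖ ^ 2} :=
    measureReal_mono fun R hR => (not_le.1 hR).le
  refine hmono.trans ?_
  rw [le_div_iff₀ hσ]
  have h1 := hmarkov.trans hval
  rw [mul_comm (_ / _), ← mul_div_assoc, ← mul_assoc, div_le_div_iff_of_pos_right hk0] at h1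
  exact le_of_mul_le_mul_right (by linarith) hι

lemma measureReal_map_rowsW_le {m n k : ℕ} (p : (Fin k → EuclideanSpace ℝ (Fin m × Fin n)) → Prop) :
    (Measure.pi fun _ : Fin n => stdGaussian (EuclideanSpace ℝ (Fin (m * k)))).real
      {X | p (rowsW X)} ≤
    (Measure.pi fun _ : Fin k => stdGaussian (EuclideanSpace ℝ (Fin m × Fin n))).real
      {R | p R} :=
  measureReal_le_of_hasLaw ⟨measurable_rowsW.aemeasurable, map_rowsW⟩ p

lemma designConditions_designW_iff {m n k : ℕ} (x : Fin n → EuclideanSpace ℝ (Fin (m * k)))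
    (c : Fin k → ℝ) (σsq lam Λsq : ℝ) :
    DesignConditions (designW x) c σsq lam Λsq ↔
      (‖(1 / (k : ℝ)) • ∑ r, c r • rowsW x r‖ ^ 2 ≤
        σsq * (Fintype.card (Fin m × Fin n) : ℝ) / (k : ℝ)) ∧
      ∀ Δ : EuclideanSpace ℝ (Fin m × Fin n), ‖Δ‖ = 1 →
        lam ≤ (1 / (k : ℝ)) * ∑ r, |inner ℝ (rowsW x r) Δ| ∧
        (1 / (k : ℝ)) * ∑ r, |inner ℝ (rowsW x r) Δ| ^ 2 ≤ Λsq := by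
  have h : ∀ (Δ : EuclideanSpace ℝ (Fin m × Fin n)) r,
      ∑ t, designW x r t * Δ t = inner ℝ (rowsW x r) Δ := fun Δ r => by
    rw [PiLp.inner_apply]
    exact Finset.sum_congr rfl fun t _ => mul_comm _ _
  simp only [DesignConditions, WeightedAverageBound, SmallBallLowerBound, QuadraticUpperBound, h,
    ← forall_and]
  exact Iff.rfl

/-- The hidden-layer design matrix satisfies the three conditions. -/
theorem exists_designConditions_designW :
    ∃ lamLow lamHigh : ℝ, 0 < lamLow ∧ 0 < lamHigh ∧
      ∀ δ : ℝ, 0 < δ → ∃ σsq κ : ℝ, 0 < σsq ∧ 0 < κ ∧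
        ∀ m n k : ℕ, 1 ≤ m → 1 ≤ n → 1 ≤ k →
          (m : ℝ) * n / k ≤ κ →
          ∀ (Ω : Type*) [MeasurableSpace Ω] (P : Measure Ω) [IsProbabilityMeasure P]
            (x : Fin n → Ω → EuclideanSpace ℝ (Fin (m * k))),
            GaussianInputs x P →
            ∀ c : Fin k → ℝ, (∀ i, |c i| ≤ 1) →
              1 - δ ≤ P.real {ω | DesignConditions (designW (fun s => x s ω)) c
                σsq lamLow (lamHigh ^ 2)} := by
  obtain ⟨lam, Λ, hlam, hΛ, H⟩ := exists_gaussian_rows_bounds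
  refine ⟨lam, Λ, hlam, hΛ, fun δ hδ => ?_⟩
  obtain ⟨κ, hκ, H⟩ := H (δ / 2) (by positivity)
  -- With `σ² = 2 / δ`, Markov's bound is exactly `δ / 2`.
  refine ⟨2 / δ, κ, by positivity, hκ, ?_⟩
  intro m n k hm hn hk hmn Ω _ P _ x hx c hc
  have hk0 : (0 : ℝ) < k := by exact_mod_cast hk
  have : Nonempty (Fin m × Fin n) := ⟨⟨⟨0, hm⟩, ⟨0, hn⟩⟩⟩
  rw [div_le_iff₀ hk0] at hmn
  have hmn1 : (1 : ℝ) ≤ m * n := by exact_mod_cast Nat.mul_le_mul hm hn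
  have hlaw : HasLaw (fun ω s => x s ω) (Measure.pi fun _ => stdGaussian _) P :=
    hx.indep.hasLaw_pi hx.law
  apply one_sub_le_measureReal_of_not_le
  refine (measureReal_le_of_hasLaw hlaw fun X => ¬ DesignConditions (designW X) c _ _ _).trans ?_
  simp_rw [designConditions_designW_iff]
  refine (measureReal_map_rowsW_le fun R => ¬ ((‖(1 / (k : ℝ)) • ∑ r, c r • R r‖ ^ 2 ≤
        2 / δ * (Fintype.card (Fin m × Fin n) : ℝ) / (k : ℝ)) ∧
      ∀ Δ : EuclideanSpace ℝ (Fin m × Fin n), ‖Δ‖ = 1 →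
        lam ≤ (1 / (k : ℝ)) * ∑ r, |inner ℝ (R r) Δ| ∧
        (1 / (k : ℝ)) * ∑ r, |inner ℝ (R r) Δ| ^ 2 ≤ Λ ^ 2)).trans ?_
  have h1 := measureReal_weighted_average_gt_le (ι := Fin m × Fin n) hk hc
    (show 0 < 2 / δ by positivity)
  have h2 := H (LinearIsometry.id (R := ℝ) (E := EuclideanSpace ℝ (Fin m × Fin n))) k hk
    (by simpa using hmn) (hmn1.trans hmn)
  rw [one_div_div] at h1
  refine le_trans ?_ ((add_le_add h1 h2).trans_eq (add_halves δ))
  exact (measureReal_mono fun R hR => not_and_or.1 hR).trans (measureReal_union_le _ _)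

/-! ### ReLU features and their symmetrization -/

lemma continuous_relu : Continuous relu := continuous_const.max continuous_id

lemma relu_sub_relu_neg (t : ℝ) : relu t - relu (-t) = t := by
  unfold relu
  rcases le_total 0 t with h | h
  · rw [max_eq_right h, max_eq_left (by linarith)]; ring
  · rw [max_eq_left h, max_eq_right (by linarith)]; ring

lemma relu_sq_le (t : ℝ) : relu t ^ 2 ≤ t ^ 2 := by
  rw [← sq_abs t]
  exact pow_le_pow_left₀ (le_max_left _ _) (max_le (abs_nonneg t) (le_abs_self t)) 2

section Relu

variable {E : Type*} [NormedAddCommGroup E] [InnerProductSpace ℝ E] {m n : ℕ}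

/-- The entry `∑ i, ψ(⟨g, u_{i,s}⟩)` of the output-layer design matrix. -/
noncomputable def reluFeature (u : Fin m × Fin n → E) (g : E) (s : Fin n) : ℝ :=
  ∑ i, relu (inner ℝ g (u (i, s)))

lemma continuous_reluFeature (u : Fin m × Fin n → E) (s : Fin n) :
    Continuous fun g => reluFeature u g s :=
  continuous_finsetSum _ fun _ _ => continuous_relu.comp (by fun_prop)

/-- Cauchy–Schwarz over the `m` patches, together with `ψ(t)² ≤ t²`. -/
lemma sum_reluFeature_sq_le (u : Fin m × Fin n → E) (g : E) :
    ∑ s, reluFeature u g s ^ 2 ≤ m * ∑ q, inner ℝ g (u q) ^ 2 := by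
  rw [Fintype.sum_prod_type_right, Finset.mul_sum]
  refine Finset.sum_le_sum fun s _ => ?_
  have h := sq_sum_le_card_mul_sum_sq (s := Finset.univ)
    (f := fun i => relu (inner ℝ g (u (i, s))))
  rw [Finset.card_univ, Fintype.card_fin] at h
  exact h.trans (mul_le_mul_of_nonneg_left (Finset.sum_le_sum fun i _ => relu_sq_le _)
    (Nat.cast_nonneg m))

lemma sum_reluFeature_sub_neg (u : Fin m × Fin n → E) (Δ : Fin n → ℝ) (g : E) :
    ∑ s, reluFeature u g s * Δ s - ∑ s, reluFeature u (-g) s * Δ s =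
      inner ℝ g (∑ q : Fin m × Fin n, Δ q.2 • u q) := by
  simp only [reluFeature, inner_neg_left, inner_sum, real_inner_smul_right,
    Fintype.sum_prod_type_right, ← Finset.sum_sub_distrib, ← sub_mul, relu_sub_relu_neg,
    Finset.sum_mul]
  exact Finset.sum_congr rfl fun s _ => Finset.sum_congr rfl fun i _ => mul_comm _ _

variable [FiniteDimensional ℝ E] [MeasurableSpace E] [BorelSpace E]

/-- Small-ball estimate for the ReLU features: symmetrizing `g ↦ -g` reduces it to one for the
Gaussian linear form obtained by replacing the ReLU by the identity. -/
lemma lintegral_exp_neg_abs_reluFeature_le {ρ : ℝ} (hρ0 : 0 ≤ ρ)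
    (hρ : ∫⁻ x, ENNReal.ofReal (Real.exp (-|x|)) ∂(gaussianReal 0 1) ≤ ENNReal.ofReal ρ)
    (u : Fin m × Fin n → E) (Δ : Fin n → ℝ) {l : ℝ} (hl : 0 < l)
    (hu : l ≤ ‖∑ q : Fin m × Fin n, Δ q.2 • u q‖) :
    ∫⁻ g, ENNReal.ofReal (Real.exp (-(2 / l * |∑ s, reluFeature u g s * Δ s|))) ∂(stdGaussian E) ≤
      ENNReal.ofReal ((1 + ρ) / 2) := by
  set b := ∑ q : Fin m × Fin n, Δ q.2 • u q with hb
  have hb0 : 0 < ‖b‖ := hl.trans_le hu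
  have hunit : ‖‖b‖⁻¹ • b‖ = 1 := norm_smul_inv_norm (𝕜 := ℝ) (norm_pos_iff.1 hb0)
  set h : E → ℝ := fun g => ∑ s, reluFeature u g s * Δ s with hh
  have hcont : Continuous h :=
    continuous_finsetSum _ fun s _ => (continuous_reluFeature u s).mul continuous_const
  set f : E → ENNReal := fun g => ENNReal.ofReal (Real.exp (-(2 / l * |h g|))) with hf
  have hfm : Measurable f := by have := hcont.measurable; fun_prop
  -- Of `g` and `-g`, the one with the larger `|h|` carries at least half of `|⟨g, b⟩|`, whence the
  -- factor `2 / l` in `f`; the other term is bounded by `1`.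
  have hpt : ∀ g, f g + f (-g) ≤
      1 + ENNReal.ofReal (Real.exp (-|inner ℝ g (‖b‖⁻¹ • b)|)) := by
    intro g
    have hdiff : h g - h (-g) = inner ℝ g b := sum_reluFeature_sub_neg u Δ g
    have hz : l * |inner ℝ g (‖b‖⁻¹ • b)| ≤ |h g| + |h (-g)| := by
      calc _ ≤ ‖b‖ * |inner ℝ g (‖b‖⁻¹ • b)| := by gcongr
        _ = |inner ℝ g b| := by
          rw [real_inner_smul_right, abs_mul, abs_of_pos (inv_pos.2 hb0),
            mul_inv_cancel_left₀ hb0.ne']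
        _ ≤ _ := by rw [← hdiff]; exact abs_sub _ _
    have hone : ∀ g, f g ≤ 1 := fun g => by
      rw [hf, ← ENNReal.ofReal_one]
      refine ENNReal.ofReal_le_ofReal (Real.exp_le_one_iff.2 ?_)
      have : 0 ≤ 2 / l * |h g| := by positivity
      linarith
    have hlarge : ∀ g', l * |inner ℝ g (‖b‖⁻¹ • b)| ≤ 2 * |h g'| →
        f g' ≤ ENNReal.ofReal (Real.exp (-|inner ℝ g (‖b‖⁻¹ • b)|)) := fun g' hg' => by
      refine ENNReal.ofReal_le_ofReal (Real.exp_le_exp.2 (neg_le_neg ?_))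
      rw [div_mul_eq_mul_div, le_div_iff₀ hl]
      linarith
    rcases le_total |h g| |h (-g)| with hle | hle
    · exact add_le_add (hone g) (hlarge (-g) (by linarith))
    · rw [add_comm]
      exact add_le_add (hone (-g)) (hlarge g (by linarith))
  have hsymm : ∫⁻ g, f (-g) ∂(stdGaussian E) = ∫⁻ g, f g ∂(stdGaussian E) := by
    rw [← lintegral_map (μ := stdGaussian E) (f := f) (g := fun g => -g) hfm measurable_neg,
      map_neg_stdGaussian]
  have htwo : 2 * ∫⁻ g, f g ∂(stdGaussian E) ≤ ENNReal.ofReal (1 + ρ) := by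
    calc _ = ∫⁻ g, (f g + f (-g)) ∂(stdGaussian E) := by
          rw [lintegral_add_left hfm, hsymm, two_mul]
      _ ≤ ∫⁻ g, (1 + ENNReal.ofReal (Real.exp (-|inner ℝ g (‖b‖⁻¹ • b)|))) ∂(stdGaussian E) :=
          lintegral_mono hpt
      _ = 1 + ∫⁻ x, ENNReal.ofReal (Real.exp (-|x|)) ∂(gaussianReal 0 1) := by
          rw [lintegral_add_left measurable_const, lintegral_comp_inner_stdGaussian
            (f := fun x => ENNReal.ofReal (Real.exp (-|x|))) hunit (by fun_prop)]
          simp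
      _ ≤ 1 + ENNReal.ofReal ρ := by gcongr
      _ = _ := by rw [ENNReal.ofReal_add zero_le_one hρ0, ENNReal.ofReal_one]
  rw [ENNReal.ofReal_div_of_pos two_pos, ENNReal.ofReal_ofNat,
    ENNReal.le_div_iff_mul_le (by simp) (by simp), mul_comm]
  exact htwo

end Relu

/-! ### Output layer with fixed inputs -/

/-- The three conditions follow from a bound on the Frobenius norm and from a lower bound on a
net of the sphere. -/
lemma designConditions_of_sum_sq_le {p n : ℕ} (hp : 1 ≤ p) (A : Matrix (Fin p) (Fin n) ℝ)
    {c : Fin p → ℝ} (hc : ∀ j, |c j| ≤ 1) {D σsq lam : ℝ} (hD : 0 < D)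
    (hσ : σsq * n = D * p) (hA : ∑ j, ∑ t, A j t ^ 2 ≤ D * p)
    {S : Set (EuclideanSpace ℝ (Fin n))}
    (hS : ∀ x : EuclideanSpace ℝ (Fin n), ‖x‖ = 1 → ∃ y ∈ S, ‖x - y‖ ≤ lam / √D)
    (hlow : ∀ y ∈ S, 2 * lam * p ≤ ∑ j, |∑ t, A j t * y t|) :
    DesignConditions A c σsq lam D := by
  have hp0 : (0 : ℝ) < p := by exact_mod_cast hp
  -- Cauchy–Schwarz row by row: the Frobenius norm dominates the operator norm.
  have hquad : ∀ z : EuclideanSpace ℝ (Fin n),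
      ∑ j, (∑ t, A j t * z t) ^ 2 ≤ D * p * ‖z‖ ^ 2 := fun z => by
    calc _ ≤ ∑ j, (∑ t, A j t ^ 2) * ‖z‖ ^ 2 := by
          refine Finset.sum_le_sum fun j _ => ?_
          rw [EuclideanSpace.real_norm_sq_eq]
          exact Finset.sum_mul_sq_le_sq_mul_sq _ _ _
      _ ≤ _ := by rw [← Finset.sum_mul]; gcongr
  have habs : ∀ z : EuclideanSpace ℝ (Fin n),
      ∑ j, |∑ t, A j t * z t| ≤ p * (√D * ‖z‖) := fun z => by
    have h := sum_abs_le_sqrt_mul_norm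
      (WithLp.toLp 2 fun j => ∑ t, A j t * z t : EuclideanSpace ℝ (Fin p))
    have h2 : ‖(WithLp.toLp 2 fun j => ∑ t, A j t * z t : EuclideanSpace ℝ (Fin p))‖ ≤
        √D * √p * ‖z‖ := by
      refine abs_le_of_sq_le_sq' ?_ (by positivity) |>.2
      rw [EuclideanSpace.real_norm_sq_eq, mul_pow, mul_pow, Real.sq_sqrt hD.le,
        Real.sq_sqrt hp0.le]
      exact hquad z
    calc _ ≤ _ := h
      _ ≤ √p * (√D * √p * ‖z‖) := by gcongr
      _ = (√p * √p) * (√D * ‖z‖) := by ring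
      _ = _ := by rw [Real.mul_self_sqrt hp0.le]
  refine ⟨?_, fun Δ hΔ => ?_, fun Δ hΔ => ?_⟩
  · rw [WeightedAverageBound, Fintype.card_fin, hσ, mul_div_cancel_right₀ _ hp0.ne', norm_smul,
      mul_pow, EuclideanSpace.real_norm_sq_eq]
    have hsum : ∑ t, ((∑ j, c j • (WithLp.toLp 2 (A j) : EuclideanSpace ℝ (Fin n))) t) ^ 2 ≤
        p * (D * p) := by
      have ht : ∀ t, ((∑ j, c j • (WithLp.toLp 2 (A j) : EuclideanSpace ℝ (Fin n))) t) ^ 2 ≤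
          p * ∑ j, A j t ^ 2 := fun t => by
        have h := sq_sum_le_card_mul_sum_sq (s := Finset.univ) (f := fun j => c j * A j t)
        rw [Finset.card_univ, Fintype.card_fin] at h
        have e : (∑ j, c j • (WithLp.toLp 2 (A j) : EuclideanSpace ℝ (Fin n))) t =
            ∑ j, c j * A j t := by simp
        rw [e]
        refine h.trans (mul_le_mul_of_nonneg_left (Finset.sum_le_sum fun j _ => ?_) hp0.le)
        rw [mul_pow]
        exact mul_le_of_le_one_left (sq_nonneg _) ((sq_le_one_iff_abs_le_one _).2 (hc j))
      calc _ ≤ ∑ t, p * ∑ j, A j t ^ 2 := Finset.sum_le_sum fun t _ => ht t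
        _ = p * ∑ j, ∑ t, A j t ^ 2 := by rw [← Finset.mul_sum, Finset.sum_comm]
        _ ≤ _ := by gcongr
    rw [Real.norm_of_nonneg (by positivity)]
    calc _ ≤ (1 / (p : ℝ)) ^ 2 * (p * (D * p)) := by gcongr
      _ = D := by field_simp
  · obtain ⟨y, hy, hΔy⟩ := hS Δ hΔ
    have hdiff : ∑ j, |∑ t, A j t * (Δ - y) t| ≤ lam * p := by
      refine (habs _).trans ?_
      have : √D * ‖Δ - y‖ ≤ √D * (lam / √D) := by gcongr
      rw [mul_div_cancel₀ _ (by positivity)] at this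
      nlinarith
    have htri : ∑ j, |∑ t, A j t * y t| ≤
        ∑ j, |∑ t, A j t * Δ t| + ∑ j, |∑ t, A j t * (Δ - y) t| := by
      rw [← Finset.sum_add_distrib]
      refine Finset.sum_le_sum fun j _ => ?_
      have : ∑ t, A j t * y t = ∑ t, A j t * Δ t - ∑ t, A j t * (Δ - y) t := by
        rw [← Finset.sum_sub_distrib]
        refine Finset.sum_congr rfl fun t _ => ?_
        rw [PiLp.sub_apply]
        ring
      rw [this]
      exact abs_sub _ _
    rw [one_div, inv_mul_eq_div, le_div_iff₀ hp0]
    linarith [hlow y hy]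
  · simp only [sq_abs]
    rw [one_div, inv_mul_eq_div, div_le_iff₀ hp0]
    simpa [hΔ] using hquad Δ

/-- Gaussian quadratic forms, summed over independent samples, exceed a large constant times their
mean with exponentially small probability only. -/
lemma exists_measureReal_sum_inner_sq_gt_le :
    ∃ T : ℝ, 0 < T ∧ ∀ {E : Type} [NormedAddCommGroup E] [InnerProductSpace ℝ E]
      [FiniteDimensional ℝ E] [MeasurableSpace E] [BorelSpace E] {α : Type} [Fintype α]
      (u : α → E) {V : ℝ}, 0 < V → ∑ a, ‖u a‖ ^ 2 ≤ V → ∀ N : ℕ,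
      (Measure.pi fun _ : Fin N => stdGaussian E).real
        {G | ¬ ∑ j, ∑ a, inner ℝ (G j) (u a) ^ 2 ≤ T * V * N} ≤ Real.exp (-N) := by
  obtain ⟨C, K, hC, hK1, hK⟩ := exists_lintegral_exp_mul_sq_gaussianReal_le
  refine ⟨(1 + Real.log K) / C, by have := Real.log_nonneg hK1; positivity, fun {E} => ?_⟩
  intro _ _ _ _ _ α _ u V hV hu N
  set T := (1 + Real.log K) / C with hT
  have h := measureReal_le_sum_le_of_lintegral_exp_le (stdGaussian E)
    (f := fun g => C / V * ∑ a, inner ℝ g (u a) ^ 2) (by fun_prop)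
    (lintegral_exp_sum_inner_sq_le hC.le hK1 hK u hu) (by linarith) N (C * T)
  rw [hT, exp_neg_mul_mul_eq_exp_neg_one hC hK1, ← Real.exp_nat_mul, mul_neg_one] at h
  refine (measureReal_mono fun G hG => ?_).trans h
  simp only [Set.mem_ofPred_eq, not_le] at hG ⊢
  rw [← Finset.mul_sum, ← hT]
  calc C * T * N = C / V * (T * V * N) := by field_simp
    _ ≤ _ := by gcongr

/-- Conditionally on the inputs, the output-layer design matrix satisfies the three conditions as
soon as the patches have bounded norms and their sums over the patch index are well conditioned. -/
theorem exists_designConditions_reluFeature {lam₀ T₀ : ℝ} (hlam₀ : 0 < lam₀) (hT₀ : 0 < T₀) :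
    ∃ D lam : ℝ, 0 < D ∧ 0 < lam ∧ ∀ δ : ℝ, 0 < δ → ∃ κ : ℝ, 0 < κ ∧
      ∀ {E : Type} [NormedAddCommGroup E] [InnerProductSpace ℝ E]
        [FiniteDimensional ℝ E] [MeasurableSpace E] [BorelSpace E] (m n p : ℕ),
        1 ≤ m → 1 ≤ n → 1 ≤ p → ((m : ℝ) * n) ^ 2 ≤ κ * p → ∀ u : Fin m × Fin n → E,
        ∑ q, ‖u q‖ ^ 2 ≤ T₀ * (m * n) →
        (∀ Δ : EuclideanSpace ℝ (Fin n), ‖Δ‖ = 1 →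
          lam₀ ≤ ‖∑ q : Fin m × Fin n, Δ q.2 • u q‖) →
        ∀ c : Fin p → ℝ, (∀ j, |c j| ≤ 1) →
          (Measure.pi fun _ : Fin p => stdGaussian E).real
            {G | ¬ DesignConditions (Matrix.of fun j s => reluFeature u (G j) s) c
              (D * (m : ℝ) ^ 2 * p) lam (D * (m : ℝ) ^ 2 * n)} ≤ δ := by
  obtain ⟨T, hT, HT⟩ := exists_measureReal_sum_inner_sq_gt_le
  obtain ⟨ρ, hρ0, hρ1, hρ⟩ := exists_lintegral_exp_neg_abs_gaussianReal_le
  set ρ' := (1 + ρ) / 2 with hρ'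
  have hρ'0 : 0 < ρ' := by positivity
  set l := -Real.log ρ' / 2 with hldef
  have hl : 0 < l := by
    have := Real.log_neg hρ'0 (by rw [hρ']; linarith)
    rw [hldef]; linarith
  -- Chernoff bounds the average below by `l * lam₀ / 2 = 2 * lam` on the net; half of it is lost in
  -- passing to the sphere.
  set lam := l * lam₀ / 4 with hlam
  have hlam0 : 0 < lam := by positivity
  set D := T * T₀ with hD
  have hD0 : 0 < D := by positivity
  refine ⟨D, lam, hD0, hlam0, fun δ hδ => ?_⟩
  set κ := min (l * lam / (4 * √D)) (min (1 * (δ / 2)) (l / 2 * (δ / 2))) with hκ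
  have hκ1 : κ ≤ l * lam / (4 * √D) := min_le_left _ _
  have hκ2 : κ ≤ 1 * (δ / 2) := (min_le_right _ _).trans (min_le_left _ _)
  have hκ3 : κ ≤ l / 2 * (δ / 2) := (min_le_right _ _).trans (min_le_right _ _)
  have hκ0 : 0 < κ := by positivity
  refine ⟨κ, hκ0, fun {E} => ?_⟩
  intro _ _ _ _ _ m n p hm hn hp hmnp u hu hlow c hc
  have hm0 : (1 : ℝ) ≤ m := by exact_mod_cast hm
  have hn0 : (1 : ℝ) ≤ n := by exact_mod_cast hn
  have hp0 : (0 : ℝ) < p := by exact_mod_cast hp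
  have hmn1 : (1 : ℝ) ≤ m * n := one_le_mul_of_one_le_of_one_le hm0 hn0
  have hκp : 1 ≤ κ * p := (one_le_pow₀ hmn1).trans hmnp
  set D' := D * (m : ℝ) ^ 2 * n with hD'
  have hD'0 : 0 < D' := by positivity
  have hsqrtD' : √D' ≤ √D * (m * n) := by
    refine Real.sqrt_le_iff.2 ⟨by positivity, ?_⟩
    rw [mul_pow, Real.sq_sqrt hD0.le, hD', mul_pow, mul_assoc]
    gcongr
    nlinarith
  obtain ⟨S, hS, hcard, hnet⟩ := exists_sphere_net (E := EuclideanSpace ℝ (Fin n))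
    (ε := lam / √D') (by positivity)
  set P := Measure.pi fun _ : Fin p => stdGaussian E
  have hsub : {G : Fin p → E | ¬ DesignConditions (Matrix.of fun j s => reluFeature u (G j) s) c
        (D * (m : ℝ) ^ 2 * p) lam D'} ⊆
      {G | ¬ ∑ j, ∑ q, inner ℝ (G j) (u q) ^ 2 ≤ T * (T₀ * (m * n)) * p} ∪
      ⋃ y ∈ S, {G | Real.log ρ' / 2 * p ≤
        ∑ j, -(2 / lam₀ * |∑ s, reluFeature u (G j) s * y s|)} := by
    intro G hG
    by_contra hG'
    simp only [Set.mem_union, Set.mem_iUnion, not_or, not_exists, Set.mem_ofPred_eq, not_le,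
      not_lt] at hG'
    refine hG (designConditions_of_sum_sq_le hp _ hc hD'0 (by rw [hD']; ring) ?_ hnet
      fun y hy => ?_)
    · calc _ ≤ ∑ j, m * ∑ q, inner ℝ (G j) (u q) ^ 2 :=
            Finset.sum_le_sum fun j _ => sum_reluFeature_sq_le u (G j)
        _ = m * ∑ j, ∑ q, inner ℝ (G j) (u q) ^ 2 := by rw [Finset.mul_sum]
        _ ≤ m * (T * (T₀ * (m * n)) * p) := by gcongr; exact hG'.1
        _ = _ := by rw [hD', hD]; ring
    · have := hG'.2 y hy
      rw [Finset.sum_neg_distrib, ← Finset.mul_sum] at this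
      simp only [Matrix.of_apply]
      set σ := ∑ j, |∑ s, reluFeature u (G j) s * y s|
      have h2 : l * p ≤ 2 * σ / lam₀ := by rw [hldef, mul_div_right_comm]; linarith
      rw [le_div_iff₀ hlam₀] at h2
      rw [hlam]
      linarith
  have hprob : ∀ y ∈ S, P.real {G | Real.log ρ' / 2 * p ≤
      ∑ j, -(2 / lam₀ * |∑ s, reluFeature u (G j) s * y s|)} ≤ Real.exp (-(l * p)) := by
    intro y hy
    have hcont : Continuous fun g => ∑ s, reluFeature u g s * y s :=
      continuous_finsetSum _ fun s _ => (continuous_reluFeature u s).mul continuous_const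
    refine (measureReal_le_sum_le_of_lintegral_exp_le (stdGaussian E)
      (f := fun g => -(2 / lam₀ * |∑ s, reluFeature u g s * y s|))
      (by have := hcont.measurable; fun_prop)
      (lintegral_exp_neg_abs_reluFeature_le hρ0.le hρ u y hlam₀ (hlow y (hS y hy))) hρ'0.le
      p _).trans_eq ?_
    rw [exp_neg_mul_eq_exp_neg hρ'0, ← Real.exp_nat_mul]
    congr 1
    rw [hldef]
    ring
  -- The mesh shrinks like `1 / √D'`, so the net's exponent is of order `n · m√n ≤ (mn)²`; the first
  -- entry of `κ` keeps it below `l p / 2`.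
  have hlogcard : 2 * (Module.finrank ℝ (EuclideanSpace ℝ (Fin n)) : ℝ) / (lam / √D') ≤
      l / 2 * p := by
    rw [finrank_euclideanSpace_fin, div_div_eq_mul_div, div_le_iff₀ hlam0]
    have h1 : 2 * (n : ℝ) * √D' ≤ 2 * √D * (m * n) ^ 2 := by
      calc 2 * (n : ℝ) * √D' ≤ 2 * (m * n) * (√D * (m * n)) := by
            gcongr
            nlinarith
        _ = _ := by ring
    have h2 : κ * (4 * √D) ≤ l * lam := by rwa [le_div_iff₀ (by positivity)] at hκ1
    have h3 : 2 * √D * ((m : ℝ) * n) ^ 2 ≤ 2 * √D * (κ * p) := by gcongr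
    have h4 : κ * (4 * √D) * p ≤ l * lam * p := by gcongr
    linarith
  calc _ ≤ _ := measureReal_mono hsub
    _ ≤ _ := measureReal_union_le _ _
    _ ≤ Real.exp (-p) +
        Real.exp (2 * (Module.finrank ℝ (EuclideanSpace ℝ (Fin n)) : ℝ) / (lam / √D')) *
          Real.exp (-(l * p)) :=
      add_le_add (HT u (by positivity) hu p)
        (measureReal_biUnion_finset_le_card_mul P S _ (Real.exp_pos _).le hcard hprob)
    _ ≤ Real.exp (-(1 * p)) + Real.exp (-(l / 2 * p)) := by
      rw [← Real.exp_add, one_mul]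
      gcongr
      linarith
    _ ≤ δ / 2 + δ / 2 := add_le_add
      (exp_neg_mul_le_of_mul_le one_pos hκ2 hκp hp0)
      (exp_neg_mul_le_of_mul_le (by positivity) hκ3 hκp hp0)
    _ = δ := by ring

/-! ### Output layer with random inputs -/

/-- The patch `P_i x_s` as a vector. -/
def patchVec {m n k : ℕ} (x : Fin n → EuclideanSpace ℝ (Fin (m * k))) (q : Fin m × Fin n) :
    EuclideanSpace ℝ (Fin k) :=
  WithLp.toLp 2 ((patchMatrix q.1).mulVec (x q.2).ofLp)

lemma patchVec_apply {m n k : ℕ} (x : Fin n → EuclideanSpace ℝ (Fin (m * k)))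
    (q : Fin m × Fin n) (r : Fin k) : patchVec x q r = rowsW x r q := rfl

lemma sum_norm_patchVec_sq {m n k : ℕ} (x : Fin n → EuclideanSpace ℝ (Fin (m * k))) :
    ∑ q, ‖patchVec x q‖ ^ 2 = ∑ r, ‖rowsW x r‖ ^ 2 := by
  simp only [EuclideanSpace.real_norm_sq_eq, patchVec_apply]
  exact Finset.sum_comm

/-- Moving the scalar from the weights to the patches leaves standard Gaussian weights and, for `α =
(√k)⁻¹`, patches of typical norm of order one. -/
lemma designBeta_smul {m n k p : ℕ} (x : Fin n → EuclideanSpace ℝ (Fin (m * k))) (α : ℝ)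
    (G : Fin p → EuclideanSpace ℝ (Fin k)) :
    designBeta x (fun j => α • G j) =
      Matrix.of fun j s => reluFeature (fun q => α • patchVec x q) (G j) s := by
  ext j s
  simp only [designBeta, Matrix.of_apply, reluFeature]
  refine Finset.sum_congr rfl fun i _ => ?_
  congr 1
  rw [WithLp.ofLp_smul, smul_dotProduct, real_inner_smul_right, smul_eq_mul, dotProduct_comm]
  rfl

/-- The isometric embedding that repeats a vector over the patch index. -/
noncomputable def repeatPatches {m n : ℕ} (hm : 1 ≤ m) :
    EuclideanSpace ℝ (Fin n) →ₗᵢ[ℝ] EuclideanSpace ℝ (Fin m × Fin n) where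
  toFun Δ := WithLp.toLp 2 fun q => (√m)⁻¹ * Δ q.2
  map_add' Δ Δ' := by ext q; simp [mul_add]
  map_smul' a Δ := by ext q; simp [mul_left_comm]
  norm_map' Δ := by
    have hm0 : (0 : ℝ) < m := by exact_mod_cast hm
    rw [← sq_eq_sq₀ (norm_nonneg _) (norm_nonneg _), EuclideanSpace.real_norm_sq_eq,
      EuclideanSpace.real_norm_sq_eq]
    simp [Fintype.sum_prod_type, mul_pow, ← Finset.mul_sum, hm0.ne']

/-- Coordinate `r` of the sum is `√(m/k)` times the inner product in `h`. Comparing the `ℓ¹` and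
`ℓ²` norms on `ℝ^k` gives the bound, with a spare factor `√m ≥ 1` discarded. -/
lemma le_norm_sum_smul_patchVec {m n k : ℕ} (hm : 1 ≤ m) (hk : 1 ≤ k)
    (x : Fin n → EuclideanSpace ℝ (Fin (m * k))) (Δ : EuclideanSpace ℝ (Fin n)) {lam : ℝ}
    (h : lam ≤ (1 / (k : ℝ)) * ∑ r, |inner ℝ (rowsW x r) (repeatPatches hm Δ)|) :
    lam ≤ ‖∑ q : Fin m × Fin n, Δ q.2 • (√k)⁻¹ • patchVec x q‖ := by
  have hk0 : (0 : ℝ) < k := by exact_mod_cast hk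
  have hm1 : (1 : ℝ) ≤ √m := Real.one_le_sqrt.2 (by exact_mod_cast hm)
  set b := ∑ q : Fin m × Fin n, Δ q.2 • (√k)⁻¹ • patchVec x q with hb
  have hbr : ∀ r, b r = √m * (√k)⁻¹ * inner ℝ (rowsW x r) (repeatPatches hm Δ) := fun r => by
    have e : inner ℝ (rowsW x r) (repeatPatches hm Δ) =
        ∑ q : Fin m × Fin n, (√m)⁻¹ * Δ q.2 * rowsW x r q := by
      rw [PiLp.inner_apply]
      rfl
    rw [e, hb, Finset.mul_sum]
    simp only [WithLp.ofLp_sum, Finset.sum_apply, PiLp.smul_apply, smul_eq_mul, patchVec_apply]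
    refine Finset.sum_congr rfl fun q _ => ?_
    field_simp
  have hsum := sum_abs_le_sqrt_mul_norm b
  have hle : ∑ r, |inner ℝ (rowsW x r) (repeatPatches hm Δ)| ≤ √k * ∑ r, |b r| := by
    rw [Finset.mul_sum]
    refine Finset.sum_le_sum fun r _ => ?_
    have hpos : 0 < √(m : ℝ) * (√(k : ℝ))⁻¹ := by
      have := one_pos.trans_le hm1
      positivity
    rw [hbr, abs_mul, abs_of_pos hpos]
    calc _ ≤ √(m : ℝ) * |inner ℝ (rowsW x r) (repeatPatches hm Δ)| :=
          le_mul_of_one_le_left (abs_nonneg _) hm1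
      _ = _ := by field_simp
  calc lam ≤ (1 / (k : ℝ)) * (√k * (√k * ‖b‖)) := by
        refine h.trans ?_
        gcongr
        exact hle.trans (by gcongr)
    _ = ‖b‖ := by
        rw [← mul_assoc √(k : ℝ), Real.mul_self_sqrt hk0.le]
        field_simp

lemma GaussianWeights.hasLaw_smul {Ω : Type*} [MeasurableSpace Ω] {P : Measure Ω}
    {k p : ℕ} (hk : 1 ≤ k) {w : Fin p → Ω → EuclideanSpace ℝ (Fin k)} (hw : GaussianWeights w P) :
    HasLaw (fun ω j => √k • w j ω)
      (Measure.pi fun _ : Fin p => stdGaussian (EuclideanSpace ℝ (Fin k))) P :=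
  iIndepFun.hasLaw_pi (fun j => HasLaw.fun_comp (Y := fun v => √k • v)
      ⟨by fun_prop, map_smul_multivariateGaussian hk⟩ (hw.law j))
    (hw.indep.comp (fun _ v => √k • v) fun _ => by fun_prop)

/-- The output-layer design matrix satisfies the three conditions. -/
theorem exists_designConditions_designBeta :
    ∃ D lamLow : ℝ, 0 < D ∧ 0 < lamLow ∧
      ∀ δ : ℝ, 0 < δ → ∃ κ : ℝ, 0 < κ ∧
        ∀ m n k p : ℕ, 1 ≤ m → 1 ≤ n → 1 ≤ k → 1 ≤ p →
          (m : ℝ) * n / Real.sqrt p ≤ κ → (n : ℝ) / k ≤ κ →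
          ∀ (Ω : Type*) [MeasurableSpace Ω] (P : Measure Ω) [IsProbabilityMeasure P]
            (x : Fin n → Ω → EuclideanSpace ℝ (Fin (m * k)))
            (w : Fin p → Ω → EuclideanSpace ℝ (Fin k)),
            GaussianInputs x P → GaussianWeights w P →
            IndepFun (fun ω s => x s ω) (fun ω j => w j ω) P →
            ∀ c : Fin p → ℝ, (∀ j, |c j| ≤ 1) →
              1 - δ ≤ P.real {ω | DesignConditions (designBeta (fun s => x s ω) (fun j => w j ω)) c
                (D * (m : ℝ) ^ 2 * p) lamLow (D * (m : ℝ) ^ 2 * n)} := by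
  obtain ⟨T, hT, HT⟩ := exists_measureReal_sum_inner_sq_gt_le
  obtain ⟨lam₀, Λ, hlam₀, -, Hrows⟩ := exists_gaussian_rows_bounds
  obtain ⟨D, lam, hD, hlam, Hrelu⟩ := exists_designConditions_reluFeature hlam₀ hT
  refine ⟨D, lam, hD, hlam, fun δ hδ => ?_⟩
  obtain ⟨κ₁, hκ₁, Hrows⟩ := Hrows (δ / 4) (by positivity)
  obtain ⟨κ₂, hκ₂, Hrelu⟩ := Hrelu (δ / 2) (by positivity)
  -- The hypothesis on `p` is squared: `κ ≤ 1` and `κ ≤ κ₂` give `κ² ≤ κ₂`. The entry `δ / 4`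
  -- handles the tail `exp(-k)`.
  set κ := min (min 1 κ₂) (min κ₁ (1 * (δ / 4))) with hκ
  have hκ0 : 0 < κ := by positivity
  refine ⟨κ, hκ0, ?_⟩
  intro m n k p hm hn hk hp hmnp hnk Ω _ P _ x w hx hw hxw c hc
  have hm1 : (1 : ℝ) ≤ m := by exact_mod_cast hm
  have hn1 : (1 : ℝ) ≤ n := by exact_mod_cast hn
  have hk0 : (0 : ℝ) < k := by exact_mod_cast hk
  have hp0 : (0 : ℝ) < p := by exact_mod_cast hp
  have hmn0 : (0 : ℝ) < m * n := by positivity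
  rw [div_le_iff₀ hk0] at hnk
  rw [div_le_iff₀ (by positivity)] at hmnp
  have hnk₁ : (n : ℝ) ≤ κ₁ * k := hnk.trans (by
    gcongr; exact (min_le_right _ _).trans (min_le_left _ _))
  have hmnp₂ : ((m : ℝ) * n) ^ 2 ≤ κ₂ * p := by
    calc ((m : ℝ) * n) ^ 2 ≤ (κ * √p) ^ 2 := by gcongr
      _ = κ * κ * p := by rw [mul_pow, Real.sq_sqrt hp0.le]; ring
      _ ≤ 1 * κ₂ * p := by
        gcongr
        · exact (min_le_left _ _).trans (min_le_left _ _)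
        · exact (min_le_left _ _).trans (min_le_right _ _)
      _ = κ₂ * p := by ring
  set μ := Measure.pi fun _ : Fin n => stdGaussian (EuclideanSpace ℝ (Fin (m * k))) with hμ
  set ν := Measure.pi fun _ : Fin p => stdGaussian (EuclideanSpace ℝ (Fin k)) with hν
  have hlawx : HasLaw (fun ω s => x s ω) μ P := hx.indep.hasLaw_pi hx.law
  have hlaww : HasLaw (fun ω j => √k • w j ω) ν P := hw.hasLaw_smul hk
  have hindep : IndepFun (fun ω s => x s ω) (fun ω j => √k • w j ω) P :=
    hxw.comp measurable_id (ψ := fun v : Fin p → EuclideanSpace ℝ (Fin k) => fun j => √k • v j)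
      (by fun_prop)
  have hlaw : HasLaw (fun ω => ((fun s => x s ω), fun j => √k • w j ω)) (μ.prod ν) P :=
    (indepFun_iff_hasLaw_prodMk_prod hlawx hlaww).1 hindep
  let good : (Fin n → EuclideanSpace ℝ (Fin (m * k))) × (Fin p → EuclideanSpace ℝ (Fin k)) → Prop :=
    fun z => DesignConditions (designBeta z.1 fun j => (√k)⁻¹ • z.2 j) c
      (D * (m : ℝ) ^ 2 * p) lam (D * (m : ℝ) ^ 2 * n)
  have hgood : ∀ ω, DesignConditions (designBeta (fun s => x s ω) (fun j => w j ω)) c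
      (D * (m : ℝ) ^ 2 * p) lam (D * (m : ℝ) ^ 2 * n) ↔
      good ((fun s => x s ω), fun j => √k • w j ω) := fun ω => by
    have : ∀ j, (√k)⁻¹ • √k • w j ω = w j ω := fun j =>
      inv_smul_smul₀ (Real.sqrt_pos.2 hk0).ne' _
    simp only [good, this]
  simp_rw [hgood]
  apply one_sub_le_measureReal_of_not_le
  refine (measureReal_le_of_hasLaw hlaw fun z => ¬ good z).trans ?_
  have hclosed : IsClosed {z | good z} := by
    refine isClosed_designConditions (fun j s => ?_) _ _ _ _
    simp only [designBeta, Matrix.of_apply, patchMatrix_mulVec, dotProduct]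
    refine continuous_finsetSum _ fun i _ => continuous_relu.comp ?_
    fun_prop
  have hmeas : MeasurableSet {z | ¬ good z} := hclosed.measurableSet.compl
  -- On the standard basis the quadratic form is the squared Frobenius norm of `A_W`, that is `∑
  -- ‖P_i x_s‖²`.
  let basis : Fin m × Fin n → EuclideanSpace ℝ (Fin m × Fin n) :=
    fun q => EuclideanSpace.single q 1
  let bad : (Fin k → EuclideanSpace ℝ (Fin m × Fin n)) → Prop := fun R =>
    (¬ ∑ r, ∑ q, inner ℝ (R r) (basis q) ^ 2 ≤ T * (m * n) * k) ∨
    ¬ ∀ Δ : EuclideanSpace ℝ (Fin n), ‖Δ‖ = 1 →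
      lam₀ ≤ (1 / (k : ℝ)) * ∑ r, |inner ℝ (R r) (repeatPatches hm Δ)| ∧
      (1 / (k : ℝ)) * ∑ r, |inner ℝ (R r) (repeatPatches hm Δ)| ^ 2 ≤ Λ ^ 2
  have hbad : μ.real {X | bad (rowsW X)} ≤ δ / 2 := by
    refine (measureReal_map_rowsW_le bad).trans ?_
    have h1 := HT basis hmn0 (by simp [basis]) k
    have h2 := Hrows (repeatPatches (n := n) hm) k hk
      (by rwa [finrank_euclideanSpace_fin]) (hn1.trans hnk₁)
    have h3 : Real.exp (-(k : ℝ)) ≤ δ / 4 := by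
      rw [← one_mul (k : ℝ)]
      exact exp_neg_mul_le_of_mul_le one_pos
        ((min_le_right _ _).trans (min_le_right _ _) : κ ≤ _) (hn1.trans hnk) hk0
    calc _ ≤ _ := measureReal_union_le _ _
      _ ≤ δ / 4 + δ / 4 := add_le_add (h1.trans h3) h2
      _ = δ / 2 := by ring
  refine (measureReal_prod_le μ ν hmeas (B := {X | bad (rowsW X)}) (ε := δ / 2) (by positivity)
    fun X hX => ?_).trans (by linarith)
  simp only [bad, Set.mem_ofPred_eq, not_or, not_not] at hX
  have hset : Prod.mk X ⁻¹' {z | ¬ good z} = {G | ¬ DesignConditions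
      (Matrix.of fun j s => reluFeature (fun q => (√k)⁻¹ • patchVec X q) (G j) s) c
      (D * (m : ℝ) ^ 2 * p) lam (D * (m : ℝ) ^ 2 * n)} := by
    ext G
    simp only [good, designBeta_smul, Set.mem_preimage, Set.mem_ofPred_eq]
  rw [hset]
  refine Hrelu m n p hm hn hp hmnp₂ _ ?_ (fun Δ hΔ =>
    le_norm_sum_smul_patchVec hm hk X Δ (hX.2 Δ hΔ).1) c hc
  have hnorm : ∑ r, ‖rowsW X r‖ ^ 2 ≤ T * (m * n) * k := by
    refine le_trans (le_of_eq ?_) hX.1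
    refine Finset.sum_congr rfl fun r _ => ?_
    rw [EuclideanSpace.real_norm_sq_eq]
    simp [basis, EuclideanSpace.inner_single_right]
  simp only [norm_smul, mul_pow, norm_inv, Real.norm_of_nonneg (Real.sqrt_nonneg _), inv_pow,
    Real.sq_sqrt hk0.le]
  rw [← Finset.mul_sum, sum_norm_patchVec_sq, inv_mul_le_iff₀ hk0]
  linarith

theorem lemma1 :
    (∃ lamLow lamHigh : ℝ, 0 < lamLow ∧ 0 < lamHigh ∧
      ∀ δ : ℝ, 0 < δ → ∃ σsq κ : ℝ, 0 < σsq ∧ 0 < κ ∧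
        ∀ m n k : ℕ, 1 ≤ m → 1 ≤ n → 1 ≤ k →
          (m : ℝ) * n / k ≤ κ →
          ∀ (Ω : Type*) [MeasurableSpace Ω] (P : Measure Ω) [IsProbabilityMeasure P]
            (x : Fin n → Ω → EuclideanSpace ℝ (Fin (m * k))),
            GaussianInputs x P →
            ∀ c : Fin k → ℝ, (∀ i, |c i| ≤ 1) →
              1 - δ ≤ P.real {ω | DesignConditions (designW (fun s => x s ω)) c
                σsq lamLow (lamHigh ^ 2)}) ∧
    (∃ C₁ C₂ lamLow : ℝ, 0 < C₁ ∧ 0 < C₂ ∧ 0 < lamLow ∧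
      ∀ δ : ℝ, 0 < δ → ∃ κ : ℝ, 0 < κ ∧
        ∀ m n k p : ℕ, 1 ≤ m → 1 ≤ n → 1 ≤ k → 1 ≤ p →
          (m : ℝ) * n / Real.sqrt p ≤ κ →
          (n : ℝ) * Real.log ((m : ℝ) * n) / k ≤ κ →
          (n : ℝ) / k ≤ κ →
          ∀ (Ω : Type*) [MeasurableSpace Ω] (P : Measure Ω) [IsProbabilityMeasure P]
            (x : Fin n → Ω → EuclideanSpace ℝ (Fin (m * k)))
            (w : Fin p → Ω → EuclideanSpace ℝ (Fin k)),
            GaussianInputs x P → GaussianWeights w P →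
            IndepFun (fun ω s => x s ω) (fun ω j => w j ω) P →
            ∀ c : Fin p → ℝ, (∀ j, |c j| ≤ 1) →
              1 - δ ≤ P.real {ω | DesignConditions (designBeta (fun s => x s ω) (fun j => w j ω)) c
                (C₁ * (m : ℝ) ^ 2 * p) lamLow (C₂ * (m : ℝ) ^ 2 * n)}) := by
  obtain ⟨D, lam, hD, hlam, H⟩ := exists_designConditions_designBeta
  refine ⟨exists_designConditions_designW, D, D, lam, hD, hD, hlam, fun δ hδ => ?_⟩
  obtain ⟨κ, hκ, H⟩ := H δ hδ
  exact ⟨κ, hκ, fun m n k p hm hn hk hp h₁ _ h₂ => H m n k p hm hn hk hp h₁ h₂⟩
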